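/- Let $k$ be a commutative unital ring of characteristic zero and $\mathcal A$ a commutative unital $k$-algebra. A formal deformation of $\mathcal A$ is an associative $k[[\lambda]]$-bilinear multiplication $\star$ on $\mathcal A[[\lambda]]$ of the form $a\star b=\sum_{r\ge 0}C_r(a,b)\lambda^r$ for $a,b\in\mathcal A$, with $C_r:\mathcal A\times\mathcal A\to\mathcal A$ $k$-bilinear and $C_0(a,b)=ab$; it is automatically unital, and it induces the Poisson bracket $\{a,b\}=C_1(a,b)-C_1(b,a)$ on $\mathcal A$. Two deformations $\star_1,\star_2$ are equivalent if there is a $k[[\lambda]]$-linear bijection $T=\mathrm{id}+\sum_{r\ge1}T_r\lambda^r$ of $\mathcal A[[\lambda]]$ with $T(a\star_1 b)=T(a)\star_2T(b)$; $\mathrm{Def}(\mathcal A)$ is the set of equivalence classes $[\star]$. For $\psi\in\mathrm{Aut}(\mathcal A)$ (the $k$-algebra automorphisms of $\mathcal A$, extended $\lambda$-linearly to $\mathcal A[[\lambda]]$), $\psi^*(\star)$ is the deformation $a\star'b=\psi^{-1}(\psi(a)\star\psi(b))$. Let $\mathrm{Pic}_{\mathcal A}(\mathcal A)$ be the group, under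 $\otimes_{\mathcal A}$, of isomorphism classes of $(\mathcal A,\mathcal A)$-equivalence bimodules $\mathcal E$ with $ax=xa$ for all $a\in\mathcal A$, $x\in\mathcal E$ (that is, of invertible $\mathcal A$-modules). For such an $\mathcal E$ and formal deformations $\star,\star'$ of $\mathcal A$, say that $\star'$ is induced from $\star$ by $\mathcal E$ if there are a $k[[\lambda]]$-bilinear right $(\mathcal A[[\lambda]],\star)$-module structure $\bullet$ on $\mathcal E[[\lambda]]$ with $x\bullet a=xa+O(\lambda)$ for $x\in\mathcal E$, $a\in\mathcal A$, and an isomorphism of $k[[\lambda]]$-algebras $\iota:(\mathcal A[[\lambda]],\star')\to\mathrm{End}_{(\mathcal A[[\lambda]],\star)}(\mathcal E[[\lambda]],\bullet)$ with $\iota(a)x=ax+O(\lambda)$ for $a\in\mathcal A$, $x\in\mathcal E$. Theorem. There is a group homomorphism $\Phi:\mathrm{Pic}_{\mathcal A}(\mathcal A)\to\mathrm{Aut}(\mathrm{Def}(\mathcal A))$, $\mathcal E\mapsto\Phi_{\mathcal E}$, i.e. an action of $\mathrm{Pic}_{\mathcal A}(\mathcal A)$ on the set $\mathrm{Def}(\mathcal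 A)$, such that for all $\mathcal E,\star,\star'$ one has $\Phi_{\mathcal E}([\star])=[\star']$ if and only if $\star'$ is induced from $\star$ by $\mathcal E$. (This property determines $\Phi$.) The action preserves Poisson brackets: if $\Phi_{\mathcal E}([\star])=[\star']$, then $\star$ and $\star'$ induce the same Poisson bracket on $\mathcal A$. Moreover, for two formal deformations $\star,\star'$ of $\mathcal A$, the unital $k[[\lambda]]$-algebras $(\mathcal A[[\lambda]],\star)$ and $(\mathcal A[[\lambda]],\star')$ are Morita equivalent (their categories of left modules are equivalent by a $k[[\lambda]]$-linear equivalence) if and only if there exists $\psi\in\mathrm{Aut}(\mathcal A)$ such that $[\star]$ and $[\psi^*(\star')]$ lie in the same orbit of $\Phi$. -/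

import Mathlib

universe u v

open scoped PowerSeries

/-- `E[[λ]]`: the formal power series `∑ xₙ λⁿ` with coefficients `xₙ` in `E`, given by their
coefficient sequences. -/
def FormalSeries (E : Type*) : Type _ := ℕ → E

namespace FormalSeries

section

variable {E : Type*}

/-- The series `∑ xₙ λⁿ` with given coefficients. -/
def mk (x : ℕ → E) : FormalSeries E := x

/-- The coefficient of `λⁿ`. -/
def coeff (n : ℕ) (x : FormalSeries E) : E := x n

@[simp] theorem coeff_mk (n : ℕ) (x : ℕ → E) : coeff n (mk x) = x n := rfl

@[ext] theorem ext {x y : FormalSeries E} (h : ∀ n, coeff n x = coeff n y) : x = y := funext h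

/-- The series `x₁ + x₂ λ + x₃ λ² + ⋯`. -/
def tail (x : FormalSeries E) : FormalSeries E := mk fun n => coeff (n + 1) x

@[simp] theorem coeff_tail (n : ℕ) (x : FormalSeries E) : coeff n (tail x) = coeff (n + 1) x := rfl

end

variable {k : Type*} [CommRing k]
variable {E F : Type*} [AddCommGroup E] [Module k E] [AddCommGroup F] [Module k F]

instance : AddCommGroup (FormalSeries E) := inferInstanceAs (AddCommGroup (ℕ → E))

@[simp] theorem coeff_zero (n : ℕ) : coeff n (0 : FormalSeries E) = 0 := rfl

@[simp] theorem coeff_add (n : ℕ) (x y : FormalSeries E) :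
    coeff n (x + y) = coeff n x + coeff n y := rfl

@[simp] theorem coeff_neg (n : ℕ) (x : FormalSeries E) : coeff n (-x) = -coeff n x := rfl

@[simp] theorem coeff_sub (n : ℕ) (x y : FormalSeries E) :
    coeff n (x - y) = coeff n x - coeff n y := rfl

/-- Multiplication of a series with coefficients in `E` by a scalar series `p ∈ k[[λ]]`
(the Cauchy product). -/
noncomputable instance : SMul k⟦X⟧ (FormalSeries E) where
  smul p x := mk fun n => ∑ ij ∈ Finset.HasAntidiagonal.antidiagonal n, PowerSeries.coeff ij.1 p • coeff ij.2 x

theorem coeff_smul (n : ℕ) (p : k⟦X⟧) (x : FormalSeries E) :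
    coeff n (p • x) =
      ∑ ij ∈ Finset.HasAntidiagonal.antidiagonal n, PowerSeries.coeff ij.1 p • coeff ij.2 x := rfl

theorem coeff_C_smul (n : ℕ) (c : k) (x : FormalSeries E) :
    coeff n ((PowerSeries.C c : k⟦X⟧) • x) = c • coeff n x := by
  rw [coeff_smul, Finset.sum_eq_single (0, n)]
  · simp
  · rintro ⟨i, j⟩ hij hne
    have hi : i ≠ 0 := by
      rintro rfl
      simp at hij
      exact hne (by simp [hij])
    simp [PowerSeries.coeff_C, hi]
  · simp

noncomputable instance : Module k⟦X⟧ (FormalSeries E) where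
  one_smul x := by
    ext n
    simpa using coeff_C_smul n (1 : k) x
  mul_smul p q x := by
    ext n
    simp only [coeff_smul, PowerSeries.coeff_mul, Finset.sum_smul, Finset.smul_sum, mul_smul]
    simp only [Finset.sum_sigma']
    apply Finset.sum_nbij' (fun ⟨⟨_, j⟩, ⟨l, m⟩⟩ ↦ ⟨(l, m + j), (m, j)⟩)
      (fun ⟨⟨i, _⟩, ⟨l, m⟩⟩ ↦ ⟨(i + l, m), (i, l)⟩) <;>
      simp only [Finset.mem_sigma, Finset.HasAntidiagonal.mem_antidiagonal] <;> grind
  smul_zero p := by ext n; simp [coeff_smul]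
  smul_add p x y := by ext n; simp [coeff_smul, Finset.sum_add_distrib]
  add_smul p q x := by ext n; simp [coeff_smul, add_smul, Finset.sum_add_distrib]
  zero_smul x := by ext n; simp [coeff_smul]

@[simp] theorem coeff_zero_X_smul (x : FormalSeries E) :
    coeff 0 ((PowerSeries.X : k⟦X⟧) • x) = 0 := by
  simp [coeff_smul]

@[simp] theorem coeff_succ_X_smul (n : ℕ) (x : FormalSeries E) :
    coeff (n + 1) ((PowerSeries.X : k⟦X⟧) • x) = coeff n x := by
  rw [coeff_smul, Finset.Nat.sum_antidiagonal_succ, Finset.sum_eq_single (0, n)]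
  · simp
  · rintro ⟨i, j⟩ hij hne
    have hi : i ≠ 0 := by
      rintro rfl
      simp at hij
      exact hne (by simp [hij])
    simp [PowerSeries.coeff_X, hi]
  · simp

/-- The inclusion `E ⊆ E[[λ]]` as constant series. -/
def const (a : E) : FormalSeries E := mk fun n => if n = 0 then a else 0

@[simp] theorem coeff_zero_const (a : E) : coeff 0 (const a) = a := rfl

@[simp] theorem coeff_succ_const (n : ℕ) (a : E) : coeff (n + 1) (const a) = 0 := rfl

theorem const_add (a b : E) : const (a + b) = const a + const b := by
  ext n; cases n <;> simp

theorem const_smul (c : k) (a : E) :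
    const (c • a) = (PowerSeries.C c : k⟦X⟧) • const a := by
  ext n; rw [coeff_C_smul]; cases n <;> simp

variable (k) in
theorem eq_const_add (x : FormalSeries E) : x = const (coeff 0 x) + (PowerSeries.X : k⟦X⟧) • tail x := by
  ext n; cases n <;> simp

/-- The solution `x` of `T x = y`, for a `k[[λ]]`-linear map `T = id + O(λ)`. -/
noncomputable def solve (T : FormalSeries E →ₗ[k⟦X⟧] FormalSeries E) : ℕ → FormalSeries E → E
  | 0, y => coeff 0 y
  | n + 1, y => coeff (n + 1) y + solve T n (tail (y - T y))

/-- A `k[[λ]]`-linear map of the form `id + O(λ)` is bijective. -/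
theorem bijective_of_coeff_zero (T : FormalSeries E →ₗ[k⟦X⟧] FormalSeries E)
    (hT : ∀ x, coeff 0 (T x) = coeff 0 x) : Function.Bijective T := by
  constructor
  · rw [injective_iff_map_eq_zero]
    have key : ∀ n, ∀ x, T x = 0 → coeff n x = 0 := by
      intro n
      induction n with
      | zero => intro x hx; rw [← hT, hx, coeff_zero]
      | succ n ih =>
        intro x hx
        have h0 : coeff 0 x = 0 := by rw [← hT, hx, coeff_zero]
        have h1 : x = (PowerSeries.X : k⟦X⟧) • tail x := by
          ext m; cases m <;> simp [h0]
        rw [← coeff_tail]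
        apply ih
        rw [h1, map_smul] at hx
        ext m
        have := congrArg (coeff (m + 1)) hx
        simpa using this
    intro x hx
    ext n
    exact key n x hx
  · intro y
    refine ⟨mk fun n => solve T n y, ?_⟩
    have hS : ∀ y : FormalSeries E, (mk fun n => solve T n y) =
        y + (PowerSeries.X : k⟦X⟧) • (mk fun n => solve T n (tail (y - T y))) := by
      intro y
      ext n
      cases n with
      | zero => rw [coeff_add, coeff_zero_X_smul, add_zero]; rfl
      | succ n => rw [coeff_add, coeff_succ_X_smul]; rfl
    have hy : ∀ y : FormalSeries E, y = T y + (PowerSeries.X : k⟦X⟧) • tail (y - T y) := by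
      intro y
      ext n
      cases n with
      | zero => simp [hT]
      | succ n => simp
    have key : ∀ n, ∀ y : FormalSeries E,
        coeff n (T (mk fun n => solve T n y)) = coeff n y := by
      intro n
      induction n with
      | zero => intro y; rw [hT]; rfl
      | succ n ih =>
        intro y
        conv_rhs => rw [hy y]
        rw [hS y, map_add, map_smul, coeff_add, coeff_add, coeff_succ_X_smul, coeff_succ_X_smul,
          ih]
    ext n
    exact key n y

/-- The coefficientwise `k[[λ]]`-linear extension of a `k`-linear bijection `E ≃ F`. -/
noncomputable def mapEquiv (e : E ≃ₗ[k] F) : FormalSeries E ≃ₗ[k⟦X⟧] FormalSeries F where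
  toFun x := mk fun n => e (coeff n x)
  invFun y := mk fun n => e.symm (coeff n y)
  left_inv x := by ext n; exact e.symm_apply_apply _
  right_inv y := by ext n; exact e.apply_symm_apply _
  map_add' x y := by ext n; exact map_add e _ _
  map_smul' p x := by
    ext n
    change e (coeff n (p • x)) = _
    rw [coeff_smul, map_sum, RingHom.id_apply, coeff_smul]
    exact Finset.sum_congr rfl fun ij _ => map_smul e _ _

@[simp] theorem coeff_mapEquiv (e : E ≃ₗ[k] F) (n : ℕ) (x : FormalSeries E) :
    coeff n (mapEquiv e x) = e (coeff n x) := rfl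

@[simp] theorem coeff_mapEquiv_symm (e : E ≃ₗ[k] F) (n : ℕ) (y : FormalSeries F) :
    coeff n ((mapEquiv e).symm y) = e.symm (coeff n y) := rfl

end FormalSeries

open FormalSeries in
/-- A formal deformation of the commutative unital `k`-algebra `A`: an associative
`k[[λ]]`-bilinear multiplication `⋆` on `A[[λ]]` that reduces to the product of `A` modulo `λ`.

By `k[[λ]]`-bilinearity `⋆` is determined by the `k`-bilinear maps
`C r (a, b) = coeff r (a ⋆ b)` for `a, b ∈ A`, so that `a ⋆ b = ∑ C r (a, b) λ ^ r`, and
`coeff_zero_mul` says that `C 0` is the product of `A`. -/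
@[ext] structure FormalDeformation (k A : Type*) [CommRing k] [CommRing A] [Algebra k A] where
  mul : FormalSeries A →ₗ[k⟦X⟧] FormalSeries A →ₗ[k⟦X⟧] FormalSeries A
  mul_assoc : ∀ x y z, mul (mul x y) z = mul x (mul y z)
  coeff_zero_mul : ∀ x y, coeff 0 (mul x y) = coeff 0 x * coeff 0 y

/-- A Poisson bracket on the commutative `k`-algebra `A`: a `k`-bilinear Lie bracket satisfying
the Leibniz rule. -/
@[ext] structure PoissonBracket (k A : Type*) [CommRing k] [CommRing A] [Algebra k A] where
  bracket : A →ₗ[k] A →ₗ[k] A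
  bracket_self : ∀ a, bracket a a = 0
  jacobi : ∀ a b c, bracket (bracket a b) c + bracket (bracket b c) a + bracket (bracket c a) b = 0
  leibniz : ∀ a b c, bracket a (b * c) = bracket a b * c + b * bracket a c

namespace FormalDeformation

open FormalSeries

variable {k A : Type*} [CommRing k] [CommRing A] [Algebra k A]

/-- A formal deformation of a unital algebra is unital. -/
theorem exists_one (D : FormalDeformation k A) :
    ∃ u : FormalSeries A, (∀ x, D.mul u x = x) ∧ ∀ x, D.mul x u = x := by
  have hL := bijective_of_coeff_zero (D.mul (const 1)) fun x => by simp [D.coeff_zero_mul]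
  have hR := bijective_of_coeff_zero (D.mul.flip (const 1)) fun x => by simp [D.coeff_zero_mul]
  obtain ⟨u, hu⟩ := hL.2 (const 1)
  obtain ⟨v, hv⟩ := hR.2 (const 1)
  rw [LinearMap.flip_apply] at hv
  have hu' : ∀ x, D.mul u x = x := fun x => hL.1 (by rw [← D.mul_assoc, hu])
  have hv' : ∀ x, D.mul x v = x := fun x => hR.1 (by
    rw [LinearMap.flip_apply, LinearMap.flip_apply, D.mul_assoc, hv])
  have huv : u = v := by rw [← hv' u, hu' v]
  exact ⟨u, hu', fun x => by rw [huv, hv' x]⟩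

/-- The unit of `(A[[λ]], ⋆)`. -/
noncomputable def one (D : FormalDeformation k A) : FormalSeries A := D.exists_one.choose

theorem one_mul (D : FormalDeformation k A) (x : FormalSeries A) : D.mul D.one x = x :=
  D.exists_one.choose_spec.1 x

theorem mul_one (D : FormalDeformation k A) (x : FormalSeries A) : D.mul x D.one = x :=
  D.exists_one.choose_spec.2 x

/-- The deformed algebra `(A[[λ]], ⋆)`, a unital associative `k[[λ]]`-algebra. -/
def Alg (_ : FormalDeformation k A) : Type _ := FormalSeries A

instance (D : FormalDeformation k A) : AddCommGroup D.Alg :=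
  inferInstanceAs (AddCommGroup (FormalSeries A))

noncomputable instance (D : FormalDeformation k A) : Module k⟦X⟧ D.Alg :=
  inferInstanceAs (Module k⟦X⟧ (FormalSeries A))

/-- The identity map from `A[[λ]]` to the deformed algebra. -/
noncomputable def toAlg (D : FormalDeformation k A) : FormalSeries A ≃ₗ[k⟦X⟧] D.Alg := LinearEquiv.refl _ _

noncomputable instance (D : FormalDeformation k A) : Ring D.Alg :=
  { (inferInstance : AddCommGroup D.Alg) with
    mul := fun x y => D.toAlg (D.mul (D.toAlg.symm x) (D.toAlg.symm y))
    one := D.toAlg D.one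
    mul_assoc := fun x y z => D.mul_assoc x y z
    one_mul := fun x => D.one_mul x
    mul_one := fun x => D.mul_one x
    left_distrib := fun x y z => map_add (D.mul x) y z
    right_distrib := fun x y z => LinearMap.map_add₂ D.mul x y z
    zero_mul := fun x => LinearMap.map_zero₂ D.mul x
    mul_zero := fun x => map_zero (D.mul x) }

noncomputable instance (D : FormalDeformation k A) : Algebra k⟦X⟧ D.Alg :=
  Algebra.ofModule (fun r x y => LinearMap.map_smul₂ D.mul r x y)
    (fun r x y => map_smul (D.mul x) r y)

theorem toAlg_mul (D : FormalDeformation k A) (x y : FormalSeries A) :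
    D.toAlg (D.mul x y) = D.toAlg x * D.toAlg y := rfl

/-- Two formal deformations `⋆₁, ⋆₂` are equivalent if there is a `k[[λ]]`-linear bijection
`T = id + O(λ)` of `A[[λ]]` with `T (x ⋆₁ y) = T x ⋆₂ T y`.  (Being `k[[λ]]`-linear, `T` is
automatically of the form `id + ∑ T r λ ^ r` with `k`-linear maps `T r`, `r ≥ 1`, on `A`.) -/
def Equivalent (D₁ D₂ : FormalDeformation k A) : Prop :=
  ∃ T : FormalSeries A ≃ₗ[k⟦X⟧] FormalSeries A,
    (∀ x, coeff 0 (T x) = coeff 0 x) ∧ ∀ x y, T (D₁.mul x y) = D₂.mul (T x) (T y)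

variable (k A) in
/-- Equivalence of formal deformations. -/
instance setoid : Setoid (FormalDeformation k A) where
  r := Equivalent
  iseqv :=
    { refl := fun _ => ⟨LinearEquiv.refl _ _, fun _ => rfl, fun _ _ => rfl⟩
      symm := by
        rintro D₁ D₂ ⟨T, h0, hT⟩
        refine ⟨T.symm, fun x => ?_, fun x y => ?_⟩
        · rw [← h0, T.apply_symm_apply]
        · apply T.injective
          rw [hT]
          simp
      trans := by
        rintro D₁ D₂ D₃ ⟨T, h0, hT⟩ ⟨S, h0', hS⟩
        exact ⟨T.trans S, fun x => by simp [h0, h0'], fun x y => by simp [hT, hS]⟩ }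

/-- The deformation `ψ^*(⋆)`, given by `x ⋆' y = ψ⁻¹ (ψ x ⋆ ψ y)`, where the algebra automorphism
`ψ` of `A` acts on the coefficients of a series. -/
noncomputable def pullback (ψ : A ≃ₐ[k] A) (D : FormalDeformation k A) : FormalDeformation k A where
  mul := (D.mul.compl₁₂ (mapEquiv ψ.toLinearEquiv).toLinearMap
    (mapEquiv ψ.toLinearEquiv).toLinearMap).compr₂ (mapEquiv ψ.toLinearEquiv).symm.toLinearMap
  mul_assoc x y z := by simp [D.mul_assoc]
  coeff_zero_mul x y := by
    apply ψ.injective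
    simp [D.coeff_zero_mul]

theorem pullback_mul (ψ : A ≃ₐ[k] A) (D : FormalDeformation k A) (x y : FormalSeries A) :
    (pullback ψ D).mul x y = (mapEquiv ψ.toLinearEquiv).symm
      (D.mul (mapEquiv ψ.toLinearEquiv x) (mapEquiv ψ.toLinearEquiv y)) := rfl

/-- The `k`-bilinear maps `C r : A × A → A` with `a ⋆ b = ∑ C r (a, b) λ ^ r` for `a, b ∈ A`. -/
noncomputable def cochain (D : FormalDeformation k A) (r : ℕ) : A →ₗ[k] A →ₗ[k] A :=
  LinearMap.mk₂ k (fun a b => coeff r (D.mul (const a) (const b)))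
    (fun a a' b => by simp [const_add])
    (fun c a b => by simp [const_smul, coeff_C_smul])
    (fun a b b' => by simp [const_add])
    (fun c a b => by simp [const_smul, coeff_C_smul])

theorem cochain_apply (D : FormalDeformation k A) (r : ℕ) (a b : A) :
    D.cochain r a b = coeff r (D.mul (const a) (const b)) := rfl

theorem coeff_one_mul (D : FormalDeformation k A) (x y : FormalSeries A) :
    coeff 1 (D.mul x y) = D.cochain 1 (coeff 0 x) (coeff 0 y) +
      coeff 0 x * coeff 1 y + coeff 1 x * coeff 0 y := by
  conv_lhs => rw [eq_const_add k x, eq_const_add k y]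
  have h1 : ∀ z : FormalSeries A, coeff 1 ((PowerSeries.X : k⟦X⟧) • z) = coeff 0 z :=
    fun z => coeff_succ_X_smul 0 z
  simp only [map_add, map_smul, LinearMap.add_apply, LinearMap.smul_apply, coeff_add, h1,
    D.coeff_zero_mul, coeff_zero_const, coeff_tail, coeff_zero_X_smul, cochain_apply]
  ring

/-- The first-order commutator `{a, b} = C 1 (a, b) - C 1 (b, a)`. -/
theorem coeff_one_commutator (D : FormalDeformation k A) (x y : FormalSeries A) :
    coeff 1 (D.mul x y - D.mul y x) =
      (D.cochain 1 - (D.cochain 1).flip) (coeff 0 x) (coeff 0 y) := by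
  simp only [coeff_sub, coeff_one_mul, LinearMap.sub_apply, LinearMap.flip_apply]
  ring

theorem coeff_zero_commutator (D : FormalDeformation k A) (x y : FormalSeries A) :
    coeff 0 (D.mul x y - D.mul y x) = 0 := by
  simp [D.coeff_zero_mul, mul_comm]

theorem coeff_two_commutator (D : FormalDeformation k A) (a b c : A) :
    coeff 2 (D.mul (D.mul (const a) (const b) - D.mul (const b) (const a)) (const c) -
      D.mul (const c) (D.mul (const a) (const b) - D.mul (const b) (const a))) =
    (D.cochain 1 - (D.cochain 1).flip) ((D.cochain 1 - (D.cochain 1).flip) a b) c := by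
  set w := D.mul (const a) (const b) - D.mul (const b) (const a) with hw
  have hw0 : w = (PowerSeries.X : k⟦X⟧) • tail w := by
    ext n
    cases n with
    | zero => simp [hw, D.coeff_zero_mul, mul_comm]
    | succ n => simp
  have h2 : ∀ z : FormalSeries A, coeff 2 ((PowerSeries.X : k⟦X⟧) • z) = coeff 1 z :=
    fun z => coeff_succ_X_smul 1 z
  conv_lhs => rw [hw0]
  rw [map_smul, map_smul, LinearMap.smul_apply, ← smul_sub, h2, coeff_one_commutator,
    coeff_tail, hw, zero_add, coeff_one_commutator]
  simp only [coeff_zero_const]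

/-- The Poisson bracket `{a, b} = C 1 (a, b) - C 1 (b, a)` induced on `A` by a formal
deformation. -/
noncomputable def poissonBracket (D : FormalDeformation k A) : PoissonBracket k A where
  bracket := D.cochain 1 - (D.cochain 1).flip
  bracket_self a := by simp
  jacobi a b c := by
    rw [← D.coeff_two_commutator a b c, ← D.coeff_two_commutator b c a,
      ← D.coeff_two_commutator c a b, ← coeff_add, ← coeff_add]
    simp only [map_sub, LinearMap.sub_apply, D.mul_assoc]
    rw [← coeff_zero (E := A) 2]
    congr 1
    abel
  leibniz a b c := by
    have h : D.mul (const a) (D.mul (const b) (const c)) -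
        D.mul (D.mul (const b) (const c)) (const a) =
        D.mul (D.mul (const a) (const b) - D.mul (const b) (const a)) (const c) +
        D.mul (const b) (D.mul (const a) (const c) - D.mul (const c) (const a)) := by
      simp only [map_sub, LinearMap.sub_apply, D.mul_assoc]
      abel
    have h1 := congrArg (coeff 1) h
    rw [coeff_add, D.coeff_one_commutator, D.coeff_one_mul (_ - _), D.coeff_one_mul _ (_ - _),
      D.coeff_one_commutator, D.coeff_one_commutator, D.coeff_zero_commutator,
      D.coeff_zero_commutator, D.coeff_zero_mul] at h1
    simpa using h1

end FormalDeformation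

/-- The set of equivalence classes of formal deformations of `A`. -/
def Defa (k A : Type*) [CommRing k] [CommRing A] [Algebra k A] : Type _ :=
  Quotient (FormalDeformation.setoid k A)

/-- The equivalence class `[⋆]`. -/
def FormalDeformation.toDefa {k A : Type*} [CommRing k] [CommRing A] [Algebra k A]
    (D : FormalDeformation k A) : Defa k A := Quotient.mk _ D

open FormalSeries in
/-- A deformation of the right `A`-module `E` with respect to the formal deformation `⋆` of `A`:
a right module structure `•` over `(A[[λ]], ⋆)` on `E[[λ]]`, `k[[λ]]`-bilinear, that reduces to
the module structure of `E` modulo `λ`.  (As `A` is commutative, the right action of `a` on `E`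
is `a • x`.) -/
structure ModuleDeformation {k A : Type*} [CommRing k] [CommRing A] [Algebra k A]
    (D : FormalDeformation k A) (E : Type*) [AddCommGroup E] [Module k E] [Module A E]
    [IsScalarTower k A E] where
  act : FormalSeries E →ₗ[k⟦X⟧] FormalSeries A →ₗ[k⟦X⟧] FormalSeries E
  act_mul : ∀ x a b, act x (D.mul a b) = act (act x a) b
  act_one : ∀ x, act x D.one = x
  coeff_zero_act : ∀ x a, coeff 0 (act x a) = coeff 0 a • coeff 0 x

/-- The `k[[λ]]`-algebra `End(E[[λ]], •)` of endomorphisms of a deformed right module over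
`(A[[λ]], ⋆)`; multiplication is composition. -/
def ModuleDeformation.endAlg {k A : Type*} [CommRing k] [CommRing A] [Algebra k A]
    {D : FormalDeformation k A} {E : Type*} [AddCommGroup E] [Module k E] [Module A E]
    [IsScalarTower k A E] (M : ModuleDeformation D E) :
    Subalgebra k⟦X⟧ (Module.End k⟦X⟧ (FormalSeries E)) where
  carrier := {f | ∀ x a, f (M.act x a) = M.act (f x) a}
  mul_mem' {f g} hf hg x a := by
    rw [Module.End.mul_apply, Module.End.mul_apply, hg, hf]
  add_mem' {f g} hf hg x a := by
    rw [LinearMap.add_apply, LinearMap.add_apply, hf, hg, map_add, LinearMap.add_apply]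
  algebraMap_mem' r x a := by
    rw [Module.algebraMap_end_apply, Module.algebraMap_end_apply, map_smul, LinearMap.smul_apply]

open FormalSeries in
/-- `IsInducedBy E ⋆ ⋆'`: the deformation `⋆'` is obtained from `⋆` through the symmetric bimodule
`E`, i.e. `[⋆'] = Φ_E([⋆])`.  That is, there are a deformation `(E[[λ]], •)` of the right module
`E` with respect to `⋆` and an isomorphism `ι : A[[λ]] → End(E[[λ]], •)` which carries `⋆'` to
the composition and makes the left action `ι` of `A[[λ]]` on `E[[λ]]` a deformation of the left
module structure of `E`: `ι(a) x = a x + O(λ)`. -/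
def IsInducedBy {k A : Type*} [CommRing k] [CommRing A] [Algebra k A]
    (E : Type*) [AddCommGroup E] [Module k E] [Module A E] [IsScalarTower k A E]
    (D D' : FormalDeformation k A) : Prop :=
  ∃ (M : ModuleDeformation D E) (ι : D'.Alg ≃ₐ[k⟦X⟧] M.endAlg),
    ∀ (a : FormalSeries A) (x : FormalSeries E),
      coeff 0 ((ι (D'.toAlg a) : Module.End k⟦X⟧ (FormalSeries E)) x) = coeff 0 a • coeff 0 x

/-!
A symmetric invertible bimodule `E` is the image of an idempotent matrix `e = (f i (x j))` over `A`,
formed from a finite dual basis of `E`, and the whole theorem can be read off from matrices over the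
deformed algebras.  The bridge is `Induces e D D'`: there is a non-unital `k[[λ]]`-algebra
homomorphism `θ` from `(A[[λ]], ⋆')` to the matrices over `(A[[λ]], ⋆)` with `θ a = a e + O(λ)`.

* `IsInducedBy E D D'` is equivalent to `Induces e D D'` for every dual basis of `E`
  (`IsInducedBy.induces`, `Induces.isInducedBy`).  A lift `ê` of `e` to an idempotent over the deformed
  algebra identifies the deformed right module `E[[λ]]` with the columns `ê Dⁿ`, and `θ` is the matrix
  of the left action.
* Since `End_A(E) = A`, the corner `e Mₙ(A) e` consists of the multiples of `e`, and a Nakayama type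
  argument (`FormalSeries.bijective_onto_of_mod_X`) shows that `θ` is an isomorphism onto the corner of
  `θ 1`.  Transporting the product of such a corner to `A[[λ]]` gives the existence of `⋆'`
  (`Induces.exists_induces`), and comparing two corners through the bimodule between them gives its
  uniqueness up to equivalence (`Induces.equivalent`).
* Applying one homomorphism to the entries of another one realises the Kronecker product of the
  idempotents, which belongs to the tensor product of the modules (`Induces.trans`); hence the
  Picard group acts.
* The Poisson bracket is preserved because the difference of the deformed left and right actions of
  `A` on `E[[λ]]` is divisible by `λ` (`IsInducedBy.poissonBracket_eq`).
* The corner of `θ 1` is full since `E` is a generator, and a ring is Morita equivalent to its full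
  corners (`IsMoritaEquivalent.of_full_corner`).  Conversely, a Morita equivalence `F` from
  `D'`-modules to `D`-modules makes `F D'` a retract of some `Dⁿ`, which identifies `D'` with a full
  corner of a matrix ring over `D` (`IsMoritaEquivalent.exists_matrix`).  Modulo `λ` the idempotent of
  this corner defines a generator whose endomorphisms commute, so an invertible module
  (`Module.Invertible.of_sum_eq_one`), and the isomorphism reduces to `a ↦ ψ(a) e` for an automorphism
  `ψ` of `A` (`exists_algEquiv_map_aug`); after twisting by `ψ` it is an instance of `Induces`.
-/

/-! ### Modules over `k[[λ]]` with an adic topology -/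

section Adic

open FormalSeries PowerSeries

variable {k : Type*} [CommRing k]

/-- A `k[[λ]]`-module on which `λ` is a non-zero-divisor and which is `λ`-adically separated. -/
class AdicSeparated (k : Type*) [CommRing k] (W : Type*) [AddCommGroup W] [Module k⟦X⟧ W] :
    Prop where
  eq_zero_of_X_smul : ∀ w : W, (X : k⟦X⟧) • w = 0 → w = 0
  eq_zero_of_forall : ∀ w : W, (∀ n : ℕ, ∃ y : W, w = (X : k⟦X⟧) ^ n • y) → w = 0

/-- A `k[[λ]]`-module in which every `λ`-adic Cauchy sequence, normalised so that consecutive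
terms `s m` and `s (m + 1)` agree modulo `λ ^ (m + 1)`, has a limit. -/
class AdicComplete (k : Type*) [CommRing k] (W : Type*) [AddCommGroup W] [Module k⟦X⟧ W] :
    Prop where
  exists_lim : ∀ s : ℕ → W, (∀ m, ∃ y, s (m + 1) - s m = (X : k⟦X⟧) ^ (m + 1) • y) →
    ∃ l, ∀ m, ∃ y, l - s m = (X : k⟦X⟧) ^ (m + 1) • y

theorem AdicSeparated.X_smul_injective {W : Type*} [AddCommGroup W] [Module k⟦X⟧ W]
    [AdicSeparated k W] {w w' : W} (h : (X : k⟦X⟧) • w = (X : k⟦X⟧) • w') : w = w' := by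
  rw [← sub_eq_zero] at h ⊢
  rw [← smul_sub] at h
  exact AdicSeparated.eq_zero_of_X_smul (k := k) _ h

variable {E F : Type*} [AddCommGroup E] [Module k E] [AddCommGroup F] [Module k F]

namespace FormalSeries

theorem eq_X_smul_tail {x : FormalSeries E} (h : coeff 0 x = 0) : x = (X : k⟦X⟧) • tail x := by
  ext n; cases n <;> simp [h]

theorem coeff_X_pow_smul_of_lt {i n : ℕ} (h : i < n) (x : FormalSeries E) :
    coeff i ((X : k⟦X⟧) ^ n • x) = 0 := by
  induction n generalizing i with
  | zero => omega
  | succ n ih =>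
    rw [pow_succ', mul_smul]
    cases i with
    | zero => simp
    | succ i => rw [coeff_succ_X_smul]; exact ih (by omega)

variable (k) in
theorem exists_eq_X_pow_smul {n : ℕ} {x : FormalSeries E} (h : ∀ i < n, coeff i x = 0) :
    ∃ y, x = (X : k⟦X⟧) ^ n • y := by
  induction n generalizing x with
  | zero => exact ⟨x, by simp⟩
  | succ n ih =>
    obtain ⟨y, hy⟩ := ih (x := tail x) fun i hi => h (i + 1) (by omega)
    exact ⟨y, by rw [pow_succ', mul_smul, ← hy]; exact eq_X_smul_tail (h 0 (by omega))⟩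

instance : AdicSeparated k (FormalSeries E) where
  eq_zero_of_X_smul w h := by
    ext n
    simpa using congrArg (coeff (n + 1)) h
  eq_zero_of_forall w h := by
    ext n
    obtain ⟨y, hy⟩ := h (n + 1)
    rw [hy, coeff_X_pow_smul_of_lt (by omega), coeff_zero]

instance : AdicComplete k (FormalSeries E) where
  exists_lim s hs := by
    have key : ∀ i m, i ≤ m → coeff i (s m) = coeff i (s i) := by
      intro i m him
      induction m, him using Nat.le_induction with
      | base => rfl
      | succ m him ih =>
        obtain ⟨y, hy⟩ := hs m
        rw [← ih, ← sub_eq_zero, ← coeff_sub, hy, coeff_X_pow_smul_of_lt (by omega)]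
    refine ⟨mk fun n => coeff n (s n), fun m => exists_eq_X_pow_smul k fun i hi => ?_⟩
    rw [coeff_sub, coeff_mk, key i m (by omega), sub_self]

/-- The coefficientwise extension of a `k`-linear map to formal series. -/
noncomputable def mapLinear (g : E →ₗ[k] F) : FormalSeries E →ₗ[k⟦X⟧] FormalSeries F where
  toFun x := mk fun n => g (coeff n x)
  map_add' x y := by ext n; exact map_add g _ _
  map_smul' p x := by
    ext n
    simp only [coeff_mk, coeff_smul, map_sum, map_smul, RingHom.id_apply]

@[simp] theorem coeff_mapLinear (g : E →ₗ[k] F) (n : ℕ) (x : FormalSeries E) :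
    coeff n (mapLinear g x) = g (coeff n x) := rfl

theorem coeff_zero_smul (p : k⟦X⟧) (x : FormalSeries E) :
    coeff 0 (p • x) = constantCoeff p • coeff 0 x := by
  simp [coeff_smul]

end FormalSeries

instance {ι : Type*} {W : ι → Type*} [∀ i, AddCommGroup (W i)] [∀ i, Module k⟦X⟧ (W i)]
    [∀ i, AdicSeparated k (W i)] : AdicSeparated k (∀ i, W i) where
  eq_zero_of_X_smul w h := funext fun i =>
    AdicSeparated.eq_zero_of_X_smul (k := k) _ (congrFun h i)
  eq_zero_of_forall w h := funext fun i =>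
    AdicSeparated.eq_zero_of_forall (k := k) _ fun n => by
      obtain ⟨y, hy⟩ := h n
      exact ⟨y i, congrFun hy i⟩

instance {ι : Type*} {W : ι → Type*} [∀ i, AddCommGroup (W i)] [∀ i, Module k⟦X⟧ (W i)]
    [∀ i, AdicComplete k (W i)] : AdicComplete k (∀ i, W i) where
  exists_lim s hs := by
    have := fun i => AdicComplete.exists_lim (k := k) (fun m => s m i) fun m => by
      obtain ⟨y, hy⟩ := hs m
      exact ⟨y i, congrFun hy i⟩
    choose l hl using this
    choose y hy using hl
    exact ⟨l, fun m => ⟨fun i => y i m, funext fun i => hy i m⟩⟩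

instance {ι κ W : Type*} [AddCommGroup W] [Module k⟦X⟧ W] [AdicSeparated k W] :
    AdicSeparated k (Matrix ι κ W) :=
  inferInstanceAs (AdicSeparated k (ι → κ → W))

instance {ι κ W : Type*} [AddCommGroup W] [Module k⟦X⟧ W] [AdicComplete k W] :
    AdicComplete k (Matrix ι κ W) :=
  inferInstanceAs (AdicComplete k (ι → κ → W))

instance {W : Type*} [AddCommGroup W] [Module k⟦X⟧ W] [AdicSeparated k W] :
    AdicSeparated k (Module.End k⟦X⟧ W) where
  eq_zero_of_X_smul f h := LinearMap.ext fun x =>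
    AdicSeparated.eq_zero_of_X_smul (k := k) _ (LinearMap.congr_fun h x)
  eq_zero_of_forall f h := LinearMap.ext fun x =>
    AdicSeparated.eq_zero_of_forall (k := k) _ fun n => by
      obtain ⟨y, hy⟩ := h n
      exact ⟨y x, LinearMap.congr_fun hy x⟩

/-- A form of Nakayama's lemma: a `k[[λ]]`-linear map from `V[[λ]]` into a `λ`-saturated
submodule `S` of a separated module which is bijective onto `S` modulo `λ` is bijective onto
`S`. -/
theorem FormalSeries.bijective_onto_of_mod_X {V W : Type*} [AddCommGroup V] [Module k V]
    [AddCommGroup W] [Module k⟦X⟧ W] [AdicSeparated k W] (L : FormalSeries V →ₗ[k⟦X⟧] W)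
    (S : Submodule k⟦X⟧ W) (hdiv : ∀ w, (X : k⟦X⟧) • w ∈ S → w ∈ S) (hLS : ∀ v, L v ∈ S)
    (hsurj : ∀ s ∈ S, ∃ (v : V) (w : W), s - L (const v) = (X : k⟦X⟧) • w)
    (hinj : ∀ v w, L v = (X : k⟦X⟧) • w → coeff 0 v = 0) :
    Function.Injective L ∧ ∀ s ∈ S, ∃ v, L v = s := by
  constructor
  · rw [injective_iff_map_eq_zero]
    have key : ∀ n, ∀ v, L v = 0 → coeff n v = 0 := by
      intro n
      induction n with
      | zero => exact fun v hv => hinj v 0 (by rw [hv, smul_zero])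
      | succ n ih =>
        intro v hv
        rw [← coeff_tail]
        apply ih
        apply AdicSeparated.eq_zero_of_X_smul (k := k)
        rw [← map_smul, ← eq_X_smul_tail (hinj v 0 (by rw [hv, smul_zero])), hv]
    exact fun v hv => FormalSeries.ext fun n => key n v hv
  · have step : ∀ s : S, ∃ (v : V) (s' : S), (s : W) - L (const v) = (X : k⟦X⟧) • (s' : W) := by
      rintro ⟨s, hs⟩
      obtain ⟨v, w, h⟩ := hsurj s hs
      exact ⟨v, ⟨w, hdiv w (h ▸ S.sub_mem hs (hLS _))⟩, h⟩
    choose c r hcr using step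
    -- the coefficients of the preimage of `s` are read off the successive remainders of `s`
    have hG : ∀ s : S, (mk fun n => c (r^[n] s) : FormalSeries V) =
        const (c s) + (X : k⟦X⟧) • mk fun n => c (r^[n] (r s)) := by
      intro s
      ext n
      cases n <;> simp
    intro s hs
    refine ⟨mk fun n => c (r^[n] ⟨s, hs⟩), ?_⟩
    symm
    rw [← sub_eq_zero]
    apply AdicSeparated.eq_zero_of_forall (k := k)
    intro n
    have key : ∀ n, ∀ s : S, ∃ y, (s : W) - L (mk fun n => c (r^[n] s)) = (X : k⟦X⟧) ^ n • y := by
      intro n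
      induction n with
      | zero => exact fun s => ⟨_, by rw [pow_zero, one_smul]⟩
      | succ n ih =>
        intro s
        obtain ⟨y, hy⟩ := ih (r s)
        refine ⟨y, ?_⟩
        rw [hG, map_add, map_smul, ← sub_sub, hcr, ← smul_sub, hy, pow_succ', mul_smul]
    exact key n ⟨s, hs⟩

/-- Idempotents lift along `R → R / λ R` when `R` is `λ`-adically separated and complete.  The lift
is the limit of the iteration of `x ↦ 3 x² - 2 x³`. -/
theorem exists_isIdempotentElem_of_mod_X {R : Type*} [Ring R] [Algebra k⟦X⟧ R] [AdicSeparated k R]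
    [AdicComplete k R] (e₀ : R) (h₀ : ∃ y, e₀ * e₀ - e₀ = (X : k⟦X⟧) • y) :
    ∃ e : R, e * e = e ∧ ∃ y, e - e₀ = (X : k⟦X⟧) • y := by
  let p : R → R := fun x => 3 * (x * x) - 2 * (x * x * x)
  have hp : ∀ x, p x * p x - p x = (x * x - x) * (x * x - x) * (4 * (x * x) - 4 * x - 3) := by
    intro x; simp only [p]; noncomm_ring
  have hp' : ∀ x, p x - x = (x * x - x) * (1 - 2 * x) := by
    intro x; simp only [p]; noncomm_ring
  let s : ℕ → R := fun n => p^[n] e₀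
  have hs : ∀ n, s (n + 1) = p (s n) := fun n => Function.iterate_succ_apply' p n e₀
  have hidem : ∀ n, ∃ y, s n * s n - s n = (X : k⟦X⟧) ^ (n + 1) • y := by
    intro n
    induction n with
    | zero => simpa [s] using h₀
    | succ n ih =>
      obtain ⟨y, hy⟩ := ih
      refine ⟨(X : k⟦X⟧) ^ n • (y * y * (4 * (s n * s n) - 4 * s n - 3)), ?_⟩
      rw [hs, hp, hy, smul_smul, ← pow_add]
      simp only [smul_mul_assoc, mul_smul_comm, smul_smul, ← pow_add]
      congr 2
      ring
  obtain ⟨e, he⟩ := AdicComplete.exists_lim (k := k) s fun m => by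
    obtain ⟨y, hy⟩ := hidem m
    exact ⟨y * (1 - 2 * s m), by rw [hs, hp', hy, smul_mul_assoc]⟩
  refine ⟨e, ?_, by simpa [s] using he 0⟩
  rw [← sub_eq_zero]
  apply AdicSeparated.eq_zero_of_forall (k := k)
  intro n
  cases n with
  | zero => exact ⟨_, by rw [pow_zero, one_smul]⟩
  | succ n =>
    obtain ⟨y, hy⟩ := he n
    obtain ⟨z, hz⟩ := hidem n
    refine ⟨y * e + s n * y - y + z, ?_⟩
    have : e * e - e = (e - s n) * e + s n * (e - s n) - (e - s n) + (s n * s n - s n) := by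
      noncomm_ring
    rw [this, hy, hz]
    simp only [smul_mul_assoc, mul_smul_comm, smul_sub, smul_add]

end Adic

/-! ### Reduction modulo `λ` of deformed algebras and of matrices over them -/

namespace FormalDeformation

open FormalSeries PowerSeries

variable {k A : Type*} [CommRing k] [CommRing A] [Algebra k A]

/-- The reduction modulo `λ` of the deformed algebra, `∑ aₙ λⁿ ↦ a₀`. -/
noncomputable def aug (D : FormalDeformation k A) : D.Alg →+* A where
  toFun a := coeff 0 (D.toAlg.symm a)
  map_zero' := rfl
  map_add' _ _ := rfl
  map_mul' a b := D.coeff_zero_mul _ _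
  map_one' := by
    have h := congrArg (coeff 0) (D.one_mul (const 1))
    rwa [D.coeff_zero_mul, coeff_zero_const, _root_.mul_one] at h

@[simp] theorem aug_toAlg (D : FormalDeformation k A) (x : FormalSeries A) :
    D.aug (D.toAlg x) = coeff 0 x := rfl

theorem coeff_zero_toAlg_symm (D : FormalDeformation k A) (a : D.Alg) :
    coeff 0 (D.toAlg.symm a) = D.aug a := rfl

theorem aug_smul (D : FormalDeformation k A) (p : k⟦X⟧) (a : D.Alg) :
    D.aug (p • a) = constantCoeff p • D.aug a :=
  FormalSeries.coeff_zero_smul p (D.toAlg.symm a)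

theorem aug_X_smul (D : FormalDeformation k A) (a : D.Alg) : D.aug ((X : k⟦X⟧) • a) = 0 := by
  simp [aug_smul]

theorem exists_eq_X_smul (D : FormalDeformation k A) {a : D.Alg} (h : D.aug a = 0) :
    ∃ b, a = (X : k⟦X⟧) • b :=
  ⟨D.toAlg (tail (D.toAlg.symm a)), FormalSeries.eq_X_smul_tail (x := D.toAlg.symm a) h⟩

/-- The element of the deformed algebra given by a constant series. -/
noncomputable def lift (D : FormalDeformation k A) (a : A) : D.Alg := D.toAlg (const a)

@[simp] theorem aug_lift (D : FormalDeformation k A) (a : A) : D.aug (D.lift a) = a := rfl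

theorem lift_add (D : FormalDeformation k A) (a b : A) : D.lift (a + b) = D.lift a + D.lift b :=
  const_add a b

theorem lift_smul (D : FormalDeformation k A) (c : k) (a : A) :
    D.lift (c • a) = (C c : k⟦X⟧) • D.lift a :=
  const_smul c a

theorem isUnit_of_aug_eq_one (D : FormalDeformation k A) {a : D.Alg} (h : D.aug a = 1) :
    IsUnit a := by
  have hL := bijective_of_coeff_zero (D.mul (D.toAlg.symm a)) fun x => by
    rw [D.coeff_zero_mul, coeff_zero_toAlg_symm, h, _root_.one_mul]
  have hR := bijective_of_coeff_zero (D.mul.flip (D.toAlg.symm a)) fun x => by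
    rw [LinearMap.flip_apply, D.coeff_zero_mul, coeff_zero_toAlg_symm, h, _root_.mul_one]
  obtain ⟨b, hb⟩ := hL.2 D.one
  obtain ⟨c, hc⟩ := hR.2 D.one
  have hb' : a * D.toAlg b = 1 := hb
  have hc' : D.toAlg c * a = 1 := hc
  exact isUnit_iff_exists_and_exists.2 ⟨⟨_, hb'⟩, ⟨_, hc'⟩⟩

instance (D : FormalDeformation k A) : AdicSeparated k D.Alg :=
  inferInstanceAs (AdicSeparated k (FormalSeries A))

instance (D : FormalDeformation k A) : AdicComplete k D.Alg :=
  inferInstanceAs (AdicComplete k (FormalSeries A))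

/-- A `k[[λ]]`-linear bijection that intertwines two deformed products, as an isomorphism of
algebras. -/
noncomputable def algEquivOfLinearEquiv {D₁ D₂ : FormalDeformation k A}
    (T : FormalSeries A ≃ₗ[k⟦X⟧] FormalSeries A) (hT : ∀ x y, T (D₁.mul x y) = D₂.mul (T x) (T y)) :
    D₁.Alg ≃ₐ[k⟦X⟧] D₂.Alg :=
  let T' : D₁.Alg ≃ₗ[k⟦X⟧] D₂.Alg := D₁.toAlg.symm.trans (T.trans D₂.toAlg)
  have hmul : ∀ x y, T' (x * y) = T' x * T' y := fun x y => hT x y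
  AlgEquiv.ofLinearEquiv T' (by
    obtain ⟨u, hu⟩ := T'.surjective 1
    rw [← _root_.mul_one (T' 1), ← hu, ← hmul, _root_.one_mul]) hmul

/-- The deformations `ψ^*(⋆)` and `⋆` are isomorphic as algebras. -/
theorem exists_algEquiv_pullback (ψ : A ≃ₐ[k] A) (D : FormalDeformation k A) :
    ∃ T : (pullback ψ D).Alg ≃ₐ[k⟦X⟧] D.Alg, ∀ d, D.aug (T d) = ψ ((pullback ψ D).aug d) :=
  ⟨algEquivOfLinearEquiv (mapEquiv ψ.toLinearEquiv) fun x y => by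
    rw [pullback_mul, LinearEquiv.apply_symm_apply], fun _ => rfl⟩

section Matrix

variable {ι κ μ : Type*} (D : FormalDeformation k A)

theorem map_aug_smul (p : k⟦X⟧) (M : Matrix ι κ D.Alg) :
    (p • M).map D.aug = constantCoeff p • M.map D.aug :=
  Matrix.ext fun _ _ => D.aug_smul _ _

theorem map_aug_X_smul (M : Matrix ι κ D.Alg) : ((X : k⟦X⟧) • M).map D.aug = 0 :=
  Matrix.ext fun _ _ => D.aug_X_smul _

theorem map_aug_sub (M N : Matrix ι κ D.Alg) :
    (M - N).map D.aug = M.map D.aug - N.map D.aug :=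
  Matrix.map_sub D.aug (map_sub D.aug) M N

theorem map_aug_mul [Fintype κ] (M : Matrix ι κ D.Alg) (N : Matrix κ μ D.Alg) :
    (M * N).map D.aug = M.map D.aug * N.map D.aug :=
  Matrix.map_mul

theorem exists_matrix_eq_X_smul {M : Matrix ι κ D.Alg} (h : M.map D.aug = 0) :
    ∃ N, M = (X : k⟦X⟧) • N := by
  choose N hN using fun i j => D.exists_eq_X_smul (a := M i j) (congrFun (congrFun h i) j)
  exact ⟨N, Matrix.ext hN⟩

theorem exists_matrix_sub_eq_X_smul {M N : Matrix ι κ D.Alg} (h : M.map D.aug = N.map D.aug) :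
    ∃ W, M - N = (X : k⟦X⟧) • W :=
  D.exists_matrix_eq_X_smul (by rw [map_aug_sub, h, sub_self])

theorem map_aug_map_lift (M : Matrix ι κ A) : (M.map D.lift).map D.aug = M := rfl

/-- An idempotent matrix over `A` lifts to an idempotent matrix over the deformed algebra. -/
theorem exists_idempotent_lift [Fintype ι] [DecidableEq ι] {e : Matrix ι ι A} (he : e * e = e) :
    ∃ ê : Matrix ι ι D.Alg, ê * ê = ê ∧ ê.map D.aug = e := by
  obtain ⟨ê, h, y, hy⟩ := exists_isIdempotentElem_of_mod_X (k := k) (e.map D.lift)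
    (D.exists_matrix_sub_eq_X_smul (by rw [map_aug_mul, map_aug_map_lift, he]))
  refine ⟨ê, h, ?_⟩
  rw [← sub_eq_zero, ← D.map_aug_map_lift e, ← map_aug_sub, hy, map_aug_X_smul]

end Matrix

end FormalDeformation

/-! ### Idempotent matrices of rank one and the relation they induce on deformations -/

section Deformation

open FormalSeries PowerSeries

/-- An idempotent matrix `e` over `A` whose corner ring `e Mₙ(A) e` consists of the scalar multiples
of `e`, the scalars being unique.  These are the idempotents whose images are invertible modules. -/
structure IsRankOneIdempotent {A ι : Type*} [CommRing A] [Fintype ι] (e : Matrix ι ι A) : Prop where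
  mul_self : e * e = e
  eq_zero_of_smul : ∀ a : A, a • e = 0 → a = 0
  exists_smul : ∀ B : Matrix ι ι A, e * B * e = B → ∃ a : A, B = a • e

variable {k A : Type*} [CommRing k] [CommRing A] [Algebra k A]

/-- `Induces e D D'`: there is a non-unital algebra homomorphism from the deformed algebra `D'` to
the matrices over `D` which reduces to `a ↦ a e` modulo `λ`.  When `e` is an idempotent with image
the invertible module `E`, this is the matrix form of `IsInducedBy E D D'`. -/
def Induces {ι : Type*} [Fintype ι] (e : Matrix ι ι A) (D D' : FormalDeformation k A) : Prop :=
  ∃ θ : D'.Alg →ₙₐ[k⟦X⟧] Matrix ι ι D.Alg, ∀ d, (θ d).map D.aug = D'.aug d • e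

namespace IsRankOneIdempotent

variable {ι : Type*} [Fintype ι] {e : Matrix ι ι A} {D : FormalDeformation k A}

/-- A `k[[λ]]`-linear map `A[[λ]] → e₂ Mₙ(D) e₁` reducing to `a ↦ a e` modulo `λ` is bijective. -/
theorem bijective_onto_corner (he : IsRankOneIdempotent e) {e₁ e₂ : Matrix ι ι D.Alg}
    (h₁ : e₁.map D.aug = e) (h₂ : e₂.map D.aug = e)
    (L : FormalSeries A →ₗ[k⟦X⟧] Matrix ι ι D.Alg) (hl : ∀ d, e₂ * L d = L d)
    (hr : ∀ d, L d * e₁ = L d) (hL : ∀ d, (L d).map D.aug = coeff 0 d • e) :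
    Function.Injective L ∧ ∀ w, e₂ * w = w → w * e₁ = w → ∃ d, L d = w := by
  let S : Submodule k⟦X⟧ (Matrix ι ι D.Alg) :=
    { carrier := {w | e₂ * w = w ∧ w * e₁ = w}
      zero_mem' := by simp
      add_mem' := fun ⟨h, h'⟩ ⟨g, g'⟩ => by
        constructor
        · rw [mul_add, h, g]
        · rw [add_mul, h', g']
      smul_mem' := fun p w ⟨h, h'⟩ => by
        constructor
        · rw [Matrix.mul_smul, h]
        · rw [Matrix.smul_mul, h'] }
  have := bijective_onto_of_mod_X L S ?_ (fun v => ⟨hl v, hr v⟩) ?_ ?_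
  · exact ⟨this.1, fun w h h' => this.2 w ⟨h, h'⟩⟩
  · rintro w ⟨h, h'⟩
    rw [Matrix.mul_smul] at h
    rw [Matrix.smul_mul] at h'
    exact ⟨AdicSeparated.X_smul_injective h, AdicSeparated.X_smul_injective h'⟩
  · rintro s ⟨h, h'⟩
    obtain ⟨a, ha⟩ := he.exists_smul (s.map D.aug) (by
      conv_rhs => rw [← h', ← h]
      rw [D.map_aug_mul, D.map_aug_mul, h₁, h₂])
    exact ⟨a, D.exists_matrix_sub_eq_X_smul (by rw [ha, hL, coeff_zero_const])⟩
  · intro v w h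
    apply he.eq_zero_of_smul
    rw [← hL, h, D.map_aug_X_smul]

end IsRankOneIdempotent

theorem NonUnitalAlgHom.mul_map_one {R B C : Type*} [CommRing R] [Ring B] [Algebra R B]
    [NonUnitalNonAssocSemiring C] [DistribMulAction R C] (θ : B →ₙₐ[R] C) (b : B) :
    θ b * θ 1 = θ b := by
  rw [← map_mul, mul_one]

theorem NonUnitalAlgHom.map_one_mul {R B C : Type*} [CommRing R] [Ring B] [Algebra R B]
    [NonUnitalNonAssocSemiring C] [DistribMulAction R C] (θ : B →ₙₐ[R] C) (b : B) :
    θ 1 * θ b = θ b := by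
  rw [← map_mul, one_mul]

namespace Induces

variable {ι κ : Type*} [Fintype ι] [Fintype κ] {e : Matrix ι ι A} {D D' D'' : FormalDeformation k A}

/-- The homomorphism underlying `Induces e D D'` identifies `D'` with a corner of a matrix ring. -/
theorem bijective_onto_corner (he : IsRankOneIdempotent e)
    (θ : D'.Alg →ₙₐ[k⟦X⟧] Matrix ι ι D.Alg) (hθ : ∀ d, (θ d).map D.aug = D'.aug d • e) :
    Function.Injective θ ∧ ∀ w, θ 1 * w = w → w * θ 1 = w → ∃ d, θ d = w := by
  have h1 : (θ 1).map D.aug = e := by rw [hθ, map_one, one_smul]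
  let L : FormalSeries A →ₗ[k⟦X⟧] Matrix ι ι D.Alg :=
    (θ : D'.Alg →ₗ[k⟦X⟧] _).comp D'.toAlg.toLinearMap
  have hL : ∀ d, L d = θ (D'.toAlg d) := fun _ => rfl
  exact he.bijective_onto_corner h1 h1 L (fun d => by rw [hL, θ.map_one_mul])
    (fun d => by rw [hL, θ.mul_map_one]) (fun d => by rw [hL, hθ, D'.aug_toAlg])

/-- Every deformation can be transported along a rank one idempotent: the corner ring cut out by
a lift of the idempotent is identified with `A[[λ]]` and its multiplication is transported. -/
theorem exists_induces (he : IsRankOneIdempotent e) (D : FormalDeformation k A) :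
    ∃ D', Induces e D D' := by
  classical
  obtain ⟨ê, hê, hêe⟩ := D.exists_idempotent_lift he.mul_self
  let N : FormalSeries A →ₗ[k⟦X⟧] Matrix ι ι D.Alg :=
    { toFun := fun d => Matrix.of fun i j => D.toAlg (mapLinear (LinearMap.mulRight k (e i j)) d)
      map_add' := fun d d' => by ext i j; simp
      map_smul' := fun p d => by ext i j; simp }
  let L : FormalSeries A →ₗ[k⟦X⟧] Matrix ι ι D.Alg :=
    (LinearMap.mulLeft k⟦X⟧ ê).comp ((LinearMap.mulRight k⟦X⟧ ê).comp N)
  have hLN : ∀ d, L d = ê * (N d * ê) := fun _ => rfl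
  have hN : ∀ d, (N d).map D.aug = coeff 0 d • e := fun _ => rfl
  have hLa : ∀ d, (L d).map D.aug = coeff 0 d • e := fun d => by
    rw [hLN, D.map_aug_mul, D.map_aug_mul, hN, hêe, Matrix.smul_mul, Matrix.mul_smul,
      he.mul_self, he.mul_self]
  have hl : ∀ d, ê * L d = L d := fun d => by rw [hLN, ← mul_assoc, hê]
  have hr : ∀ d, L d * ê = L d := fun d => by rw [hLN, mul_assoc, mul_assoc, hê]
  obtain ⟨hinj, hsurj⟩ := he.bijective_onto_corner hêe hêe L hl hr hLa
  have hmul : ∀ x y, ∃ z, L z = L x * L y := fun x y =>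
    hsurj _ (by rw [← mul_assoc, hl]) (by rw [mul_assoc, hr])
  choose m hm using hmul
  -- the product of the corner ring, transported along `L`
  let D' : FormalDeformation k A :=
    { mul := LinearMap.mk₂ k⟦X⟧ m
        (fun x y z => hinj (by simp only [hm, map_add, add_mul]))
        (fun p x z => hinj (by simp only [hm, map_smul, smul_mul_assoc]))
        (fun x y z => hinj (by simp only [hm, map_add, mul_add]))
        (fun p x z => hinj (by simp only [hm, map_smul, mul_smul_comm]))
      mul_assoc := fun x y z => hinj (by simp only [LinearMap.mk₂_apply, hm, mul_assoc])
      coeff_zero_mul := fun x y => by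
        rw [← sub_eq_zero]
        apply he.eq_zero_of_smul
        rw [sub_smul, ← hLa, LinearMap.mk₂_apply, hm, D.map_aug_mul, hLa, hLa, Matrix.smul_mul,
          Matrix.mul_smul, he.mul_self, smul_smul, sub_self] }
  exact ⟨D', { L.comp D'.toAlg.symm.toLinearMap with
      map_zero' := map_zero L
      map_mul' := fun x y => hm _ _ }, fun d => hLa d⟩

/-- The deformation induced by a rank one idempotent is unique up to equivalence.  If `θ₁` and
`θ₂` realise `D₁` and `D₂`, both act freely on the bimodule `θ₂(1) Mₙ(D) θ₁(1)` from the right and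
from the left, and the equivalence `T` is determined by `θ₂ (T d) θ₁(1) = θ₂(1) θ₁ d`. -/
theorem equivalent (he : IsRankOneIdempotent e) {D₁ D₂ : FormalDeformation k A}
    (h₁ : Induces e D D₁) (h₂ : Induces e D D₂) : D₁.Equivalent D₂ := by
  classical
  obtain ⟨θ₁, h₁⟩ := h₁
  obtain ⟨θ₂, h₂⟩ := h₂
  have h₁1 : (θ₁ 1).map D.aug = e := by rw [h₁, map_one, one_smul]
  have h₂1 : (θ₂ 1).map D.aug = e := by rw [h₂, map_one, one_smul]
  let L₁ : FormalSeries A →ₗ[k⟦X⟧] Matrix ι ι D.Alg :=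
    (LinearMap.mulLeft k⟦X⟧ (θ₂ 1)).comp ((θ₁ : D₁.Alg →ₗ[k⟦X⟧] _).comp D₁.toAlg.toLinearMap)
  let L₂ : FormalSeries A →ₗ[k⟦X⟧] Matrix ι ι D.Alg :=
    (LinearMap.mulRight k⟦X⟧ (θ₁ 1)).comp ((θ₂ : D₂.Alg →ₗ[k⟦X⟧] _).comp D₂.toAlg.toLinearMap)
  have hL₁ : ∀ d, L₁ d = θ₂ 1 * θ₁ (D₁.toAlg d) := fun _ => rfl
  have hL₂ : ∀ d, L₂ d = θ₂ (D₂.toAlg d) * θ₁ 1 := fun _ => rfl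
  have a₁ : ∀ d, (L₁ d).map D.aug = coeff 0 d • e := fun d => by
    rw [hL₁, D.map_aug_mul, h₁, h₂1, Matrix.mul_smul, he.mul_self, D₁.aug_toAlg]
  have a₂ : ∀ d, (L₂ d).map D.aug = coeff 0 d • e := fun d => by
    rw [hL₂, D.map_aug_mul, h₂, h₁1, Matrix.smul_mul, he.mul_self, D₂.aug_toAlg]
  have l₁ : ∀ d, θ₂ 1 * L₁ d = L₁ d := fun d => by rw [hL₁, ← mul_assoc, θ₂.mul_map_one]
  have r₁ : ∀ d, L₁ d * θ₁ 1 = L₁ d := fun d => by rw [hL₁, mul_assoc, θ₁.mul_map_one]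
  have l₂ : ∀ d, θ₂ 1 * L₂ d = L₂ d := fun d => by rw [hL₂, ← mul_assoc, θ₂.map_one_mul]
  have r₂ : ∀ d, L₂ d * θ₁ 1 = L₂ d := fun d => by rw [hL₂, mul_assoc, θ₁.mul_map_one]
  obtain ⟨i₁, s₁⟩ := he.bijective_onto_corner h₁1 h₂1 L₁ l₁ r₁ a₁
  obtain ⟨i₂, s₂⟩ := he.bijective_onto_corner h₁1 h₂1 L₂ l₂ r₂ a₂
  choose T hT using fun d => s₂ (L₁ d) (l₁ d) (r₁ d)
  choose S hS using fun d => s₁ (L₂ d) (l₂ d) (r₂ d)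
  refine ⟨{ toFun := T
            map_add' := fun x y => i₂ (by simp only [hT, map_add])
            map_smul' := fun p x => i₂ (by simp only [hT, map_smul, RingHom.id_apply])
            invFun := S
            left_inv := fun x => i₁ (by rw [hS, hT])
            right_inv := fun x => i₂ (by rw [hT, hS]) }, fun x => ?_, fun x y => i₂ ?_⟩
  · change coeff 0 (T x) = coeff 0 x
    rw [← sub_eq_zero]
    apply he.eq_zero_of_smul
    rw [sub_smul, ← a₂, hT, a₁, sub_self]
  · change L₂ (T (D₁.mul x y)) = L₂ (D₂.mul (T x) (T y))
    have hx : θ₂ 1 * θ₁ (D₁.toAlg x) = θ₂ (D₂.toAlg (T x)) * θ₁ 1 := by rw [← hL₁, ← hL₂, hT]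
    have hy : θ₂ 1 * θ₁ (D₁.toAlg y) = θ₂ (D₂.toAlg (T y)) * θ₁ 1 := by rw [← hL₁, ← hL₂, hT]
    rw [hT, hL₁, hL₂, D₁.toAlg_mul, D₂.toAlg_mul, map_mul, map_mul, ← mul_assoc, hx, mul_assoc,
      θ₁.map_one_mul, mul_assoc, ← hy, ← mul_assoc, θ₂.mul_map_one]

/-- Equivalent deformations are isomorphic as algebras. -/
theorem _root_.FormalDeformation.Equivalent.exists_algEquiv {D₁ D₂ : FormalDeformation k A}
    (h : D₁.Equivalent D₂) : ∃ T : D₁.Alg ≃ₐ[k⟦X⟧] D₂.Alg, ∀ d, D₂.aug (T d) = D₁.aug d := by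
  obtain ⟨T, h0, hT⟩ := h
  exact ⟨FormalDeformation.algEquivOfLinearEquiv T hT, h0⟩

theorem congr_left {D₁ : FormalDeformation k A} (h : D.Equivalent D₁) (hD : Induces e D D') :
    Induces e D₁ D' := by
  classical
  obtain ⟨T, hT⟩ := h.exists_algEquiv
  obtain ⟨θ, hθ⟩ := hD
  refine ⟨NonUnitalAlgHom.comp (AlgHom.toNonUnitalAlgHom T.toAlgHom.mapMatrix) θ, fun d => ?_⟩
  rw [← hθ]
  ext i j
  exact hT (θ d i j)

theorem congr_right {D₁ : FormalDeformation k A} (h : D'.Equivalent D₁) (hD : Induces e D D') :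
    Induces e D D₁ := by
  obtain ⟨T, hT⟩ := h.exists_algEquiv
  obtain ⟨θ, hθ⟩ := hD
  refine ⟨θ.comp (AlgHom.toNonUnitalAlgHom T.symm.toAlgHom), fun d => ?_⟩
  have := hT (T.symm d)
  rw [T.apply_symm_apply] at this
  rw [this]
  exact hθ (T.symm d)

theorem refl (D : FormalDeformation k A) : Induces (1 : Matrix Unit Unit A) D D := by
  refine ⟨(Matrix.scalarAlgHom Unit k⟦X⟧).toNonUnitalAlgHom, fun d => ?_⟩
  ext i j
  change D.aug (Matrix.scalar Unit d i j) = _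
  simp

/-- Applying `θ` to the entries of the matrices `θ'` composes the two relations; the idempotents are
combined by the Kronecker product. -/
theorem trans {e' : Matrix κ κ A} (h' : Induces e' D' D'') (h : Induces e D D') :
    Induces (Matrix.kroneckerMap (fun a b => a * b) e' e) D D'' := by
  obtain ⟨θ', hθ'⟩ := h'
  obtain ⟨θ, hθ⟩ := h
  refine ⟨{ toFun := fun d => Matrix.of fun i j => θ (θ' d i.1 j.1) i.2 j.2
            map_smul' := fun p d => by ext i j; simp
            map_zero' := by ext i j; simp
            map_add' := fun x y => by ext i j; simp
            map_mul' := fun x y => ?_ }, fun d => ?_⟩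
  · ext i j
    simp only [Matrix.of_apply, map_mul, Matrix.mul_apply, map_sum, Matrix.sum_apply,
      Fintype.sum_prod_type]
  · ext i j
    have h1 := congrFun (congrFun (hθ (θ' d i.1 j.1)) i.2) j.2
    have h2 := congrFun (congrFun (hθ' d) i.1) j.1
    simp only [Matrix.map_apply, Matrix.smul_apply, smul_eq_mul] at h1 h2
    simp only [Matrix.map_apply, Matrix.smul_apply, smul_eq_mul, Matrix.kroneckerMap_apply]
    rw [← mul_assoc, ← h2, ← h1]
    rfl

end Induces

/-! ### Dual bases of invertible modules -/

/-- A finite dual basis of a module: vectors `x i` and functionals `f i` such that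
`y = ∑ f i (y) x i` for all `y`. -/
structure DualBasis (A E ι : Type*) [CommRing A] [AddCommGroup E] [Module A E] [Fintype ι] where
  vec : ι → E
  fn : ι → Module.Dual A E
  sum_smul : ∀ y, ∑ i, fn i y • vec i = y

namespace DualBasis

variable {E E' ι κ : Type*} [AddCommGroup E] [Module A E] [AddCommGroup E'] [Module A E']
  [Fintype ι] [Fintype κ]

/-- The idempotent matrix `f i (x j)`, whose image is isomorphic to the module. -/
def gram (b : DualBasis A E ι) : Matrix ι ι A := Matrix.of fun i j => b.fn i (b.vec j)

theorem gram_apply (b : DualBasis A E ι) (i j : ι) : b.gram i j = b.fn i (b.vec j) := rfl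

theorem fn_sum_smul (b : DualBasis A E ι) (c : ι → A) (i : ι) :
    b.fn i (∑ j, c j • b.vec j) = ∑ j, b.gram i j * c j := by
  simp [gram_apply, mul_comm]

theorem sum_gram_mul_fn (b : DualBasis A E ι) (i : ι) (y : E) :
    ∑ j, b.gram i j * b.fn j y = b.fn i y := by
  rw [← fn_sum_smul, b.sum_smul]

theorem gram_mul_gram (b : DualBasis A E ι) : b.gram * b.gram = b.gram :=
  Matrix.ext fun i j => b.sum_gram_mul_fn i (b.vec j)

theorem isRankOneIdempotent (b : DualBasis A E ι) [Module.Invertible A E] :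
    IsRankOneIdempotent b.gram where
  mul_self := b.gram_mul_gram
  eq_zero_of_smul a ha := by
    have h : ∀ i j, a * b.fn i (b.vec j) = 0 := fun i j => congrFun (congrFun ha i) j
    apply FaithfulSMul.eq_of_smul_eq_smul (α := E)
    intro y
    rw [zero_smul, ← b.sum_smul y, Finset.smul_sum]
    refine Finset.sum_eq_zero fun j _ => ?_
    have : a • b.vec j = 0 := by
      rw [← b.sum_smul (b.vec j), Finset.smul_sum]
      exact Finset.sum_eq_zero fun i _ => by rw [smul_smul, h, zero_smul]
    rw [smul_comm, this, smul_zero]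
  exists_smul B hB := by
    let φ : E →ₗ[A] E := ∑ i, ∑ j, B i j • (b.fn j).smulRight (b.vec i)
    have hφ : ∀ y, φ y = ∑ i, (∑ j, B i j * b.fn j y) • b.vec i := fun y => by
      simp [φ, Finset.sum_smul, mul_smul]
    obtain ⟨a, ha⟩ := (Module.Invertible.toModuleEnd_bijective A E).2 φ
    refine ⟨a, Matrix.ext fun i j => ?_⟩
    have h1 : φ (b.vec j) = a • b.vec j := by rw [← ha]; rfl
    have h2 := congrArg (b.fn i) h1
    rw [hφ, fn_sum_smul, map_smul] at h2
    rw [← hB, mul_assoc]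
    exact h2

/-- Transport of a dual basis along an isomorphism; the idempotent does not change. -/
def map (b : DualBasis A E ι) (φ : E ≃ₗ[A] E') : DualBasis A E' ι where
  vec i := φ (b.vec i)
  fn i := (b.fn i).comp φ.symm.toLinearMap
  sum_smul y := by
    have := congrArg φ (b.sum_smul (φ.symm y))
    simpa using this

theorem gram_map (b : DualBasis A E ι) (φ : E ≃ₗ[A] E') : (b.map φ).gram = b.gram := by
  ext i j
  simp [gram_apply, map]

open TensorProduct in
/-- The dual basis of a tensor product, indexed by pairs. -/
noncomputable def tensor (b : DualBasis A E ι) (b' : DualBasis A E' κ) :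
    DualBasis A (E ⊗[A] E') (ι × κ) where
  vec i := b.vec i.1 ⊗ₜ b'.vec i.2
  fn i := TensorProduct.dualDistrib A E E' (b.fn i.1 ⊗ₜ b'.fn i.2)
  sum_smul y := by
    induction y with
    | zero => simp
    | add y z hy hz =>
      simp only [map_add, add_smul, Finset.sum_add_distrib, hy, hz]
    | tmul y z =>
      conv_rhs => rw [← b.sum_smul y, ← b'.sum_smul z, sum_tmul]
      rw [Fintype.sum_prod_type]
      refine Finset.sum_congr rfl fun i _ => ?_
      rw [tmul_sum]
      refine Finset.sum_congr rfl fun j _ => ?_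
      rw [dualDistrib_apply, smul_tmul_smul]

theorem gram_tensor (b : DualBasis A E ι) (b' : DualBasis A E' κ) :
    (b.tensor b').gram = Matrix.kroneckerMap (fun a b => a * b) b.gram b'.gram := rfl

/-- The dual basis of the ring itself consisting of `1` and the identity. -/
def self (A : Type*) [CommRing A] : DualBasis A A Unit where
  vec _ := 1
  fn _ := LinearMap.id
  sum_smul y := by simp

theorem gram_self : (self A).gram = 1 := by
  ext i j
  simp [gram_apply, self]

variable (A E) in
/-- A finite projective module has a finite dual basis; a zero vector is adjoined to make the index
type nonempty, as the Morita equivalence with a matrix ring requires. -/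
theorem exists_fin [Module.Finite A E] [Module.Projective A E] :
    ∃ n, Nonempty (DualBasis A E (Fin (n + 1))) := by
  obtain ⟨n, f, g, -, -, hfg⟩ := Module.Finite.exists_comp_eq_id_of_projective A E
  refine ⟨n, ⟨{ vec := Fin.cons 0 fun i => f (Pi.single i 1)
                fn := Fin.cons 0 fun i => (LinearMap.proj i).comp g
                sum_smul := fun y => ?_ }⟩⟩
  rw [Fin.sum_univ_succ]
  simp only [Fin.cons_zero, Fin.cons_succ, smul_zero, zero_add, LinearMap.comp_apply,
    LinearMap.proj_apply, ← map_smul, ← map_sum]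
  conv_rhs => rw [← LinearMap.id_apply (R := A) y, ← hfg, LinearMap.comp_apply]
  congr 1
  conv_rhs => rw [← Finset.univ_sum_single (g y)]
  refine Finset.sum_congr rfl fun i _ => ?_
  rw [← Pi.single_smul, smul_eq_mul, mul_one]

end DualBasis

/-! ### Module deformations and matrices -/

section ColumnSpace

variable {ι : Type*} [Fintype ι] {D D' : FormalDeformation k A}

/-- The right module `ê Dⁿ` of columns fixed by the matrix `ê`. -/
def columnSpace (ê : Matrix ι ι D.Alg) : Submodule k⟦X⟧ (ι → D.Alg) where
  carrier := {v | ê.mulVec v = v}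
  zero_mem' := Matrix.mulVec_zero ê
  add_mem' {v w} hv hw := by
    change ê.mulVec (v + w) = v + w
    rw [Matrix.mulVec_add, hv, hw]
  smul_mem' p v hv := by
    change ê.mulVec (p • v) = p • v
    rw [Matrix.mulVec_smul, hv]

theorem mem_columnSpace {ê : Matrix ι ι D.Alg} {v : ι → D.Alg} :
    v ∈ columnSpace ê ↔ ê.mulVec v = v := Iff.rfl

theorem mul_right_mem_columnSpace {ê : Matrix ι ι D.Alg} {v : ι → D.Alg} (hv : v ∈ columnSpace ê)
    (a : D.Alg) : (fun i => v i * a) ∈ columnSpace ê := by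
  rw [mem_columnSpace] at hv ⊢
  ext i
  conv_rhs => rw [← hv]
  simp only [Matrix.mulVec, dotProduct, Finset.sum_mul, mul_assoc]

theorem aug_mulVec (M : Matrix ι ι D.Alg) (v : ι → D.Alg) (i : ι) :
    D.aug (M.mulVec v i) = ∑ j, M.map D.aug i j * D.aug (v j) := by
  simp [Matrix.mulVec, dotProduct]

/-- Modulo `λ`, the columns in `ê Dⁿ` are the coordinates of a vector of the module. -/
theorem DualBasis.aug_eq_fn_of_mem_columnSpace {E : Type*} [AddCommGroup E] [Module A E]
    (b : DualBasis A E ι) {ê : Matrix ι ι D.Alg} (ha : ê.map D.aug = b.gram) {v : ι → D.Alg} (hv : v ∈ columnSpace ê) (i : ι) :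
    D.aug (v i) = b.fn i (∑ j, D.aug (v j) • b.vec j) := by
  conv_lhs => rw [← mem_columnSpace.1 hv]
  rw [aug_mulVec, fn_sum_smul, ha]

variable {E : Type*} [AddCommGroup E] [Module k E] [Module A E] [IsScalarTower k A E]

/-- If `ê` is an idempotent over the deformed algebra lifting the idempotent of a dual basis of `E`,
then `E[[λ]]` is isomorphic to `ê Dⁿ`, by an isomorphism which takes coordinates modulo `λ`. -/
theorem DualBasis.exists_columnSpace_equiv (b : DualBasis A E ι) {ê : Matrix ι ι D.Alg}
    (hê : ê * ê = ê) (ha : ê.map D.aug = b.gram) : ∃ β : FormalSeries E ≃ₗ[k⟦X⟧] columnSpace ê,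
      ∀ z i, D.aug ((β z : ι → D.Alg) i) = b.fn i (coeff 0 z) := by
  let N : FormalSeries E →ₗ[k⟦X⟧] (ι → D.Alg) :=
    LinearMap.pi fun i => D.toAlg.toLinearMap.comp (mapLinear ((b.fn i).restrictScalars k))
  have hN : ∀ z i, D.aug (N z i) = b.fn i (coeff 0 z) := fun _ _ => rfl
  let L : FormalSeries E →ₗ[k⟦X⟧] (ι → D.Alg) :=
    { toFun := fun z => ê.mulVec (N z)
      map_add' := fun y z => by rw [map_add, Matrix.mulVec_add]
      map_smul' := fun p z => by rw [map_smul, Matrix.mulVec_smul, RingHom.id_apply] }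
  have hLS : ∀ z, L z ∈ columnSpace ê := fun z => by
    rw [mem_columnSpace]
    change ê.mulVec (ê.mulVec _) = ê.mulVec _
    rw [Matrix.mulVec_mulVec, hê]
  have hL : ∀ z i, D.aug (L z i) = b.fn i (coeff 0 z) := fun z i => by
    change D.aug (ê.mulVec (N z) i) = _
    rw [aug_mulVec, ha]
    simp only [hN, b.sum_gram_mul_fn]
  have key := bijective_onto_of_mod_X L (columnSpace ê) (fun w hw => ?_) hLS
    (fun s hs => ?_) (fun z w h => ?_)
  · exact ⟨LinearEquiv.ofBijective (L.codRestrict _ hLS)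
      ⟨fun x y h => key.1 (congrArg Subtype.val h), fun s => by
        obtain ⟨z, hz⟩ := key.2 s s.2
        exact ⟨z, Subtype.ext hz⟩⟩, hL⟩
  · rw [mem_columnSpace, Matrix.mulVec_smul] at hw
    exact AdicSeparated.X_smul_injective hw
  · choose w hw using fun i => D.exists_eq_X_smul
      (a := s i - L (const (∑ j, D.aug (s j) • b.vec j)) i) (by
        rw [map_sub, hL, coeff_zero_const, b.aug_eq_fn_of_mem_columnSpace ha hs, sub_self])
    exact ⟨_, w, funext hw⟩
  · have h0 : ∀ i, b.fn i (coeff 0 z) = 0 := fun i => by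
      rw [← hL, h]
      exact D.aug_X_smul _
    rw [← b.sum_smul (coeff 0 z)]
    exact Finset.sum_eq_zero fun i _ => by rw [h0, zero_smul]

/-- Over an invertible module, a left action of `D'` on a module deformation over `D` by
endomorphisms that deforms the given action is automatically an isomorphism onto the endomorphism
algebra, because `A` is the endomorphism ring of `E`. -/
theorem isInducedBy_of_algHom [Module.Invertible A E] (M : ModuleDeformation D E)
    (f : D'.Alg →ₐ[k⟦X⟧] M.endAlg)
    (hf : ∀ a x, coeff 0 ((f a : Module.End k⟦X⟧ (FormalSeries E)) x) = D'.aug a • coeff 0 x) :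
    IsInducedBy E D D' := by
  let L : FormalSeries A →ₗ[k⟦X⟧] Module.End k⟦X⟧ (FormalSeries E) :=
    M.endAlg.val.toLinearMap.comp (f.toLinearMap.comp D'.toAlg.toLinearMap)
  have hL : ∀ a, L a = f (D'.toAlg a) := fun _ => rfl
  have hX : ∀ g : Module.End k⟦X⟧ (FormalSeries E), (∀ x, coeff 0 (g x) = 0) →
      ∃ h, g = (X : k⟦X⟧) • h := by
    intro g hg
    refine ⟨{ toFun := fun x => tail (g x)
              map_add' := fun x y => ?_
              map_smul' := fun p x => ?_ }, LinearMap.ext fun x => eq_X_smul_tail (hg x)⟩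
    · rw [map_add]
      rfl
    · apply AdicSeparated.X_smul_injective (k := k)
      rw [RingHom.id_apply, smul_comm, ← eq_X_smul_tail (hg x), ← map_smul,
        ← eq_X_smul_tail (hg (p • x))]
  have key := bijective_onto_of_mod_X L M.endAlg.toSubmodule (fun g hg x a => ?_)
    (fun a => (f (D'.toAlg a)).2) (fun g hg => ?_) (fun a g h => ?_)
  · refine ⟨M, AlgEquiv.ofBijective f ⟨fun x y h => ?_, fun g => ?_⟩,
      fun a x => hf (D'.toAlg a) x⟩
    · exact key.1 (congrArg Subtype.val h)
    · obtain ⟨a, ha⟩ := key.2 g g.2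
      exact ⟨D'.toAlg a, Subtype.ext ha⟩
  · apply AdicSeparated.X_smul_injective (k := k)
    have := hg x a
    rwa [LinearMap.smul_apply, LinearMap.smul_apply, map_smul, LinearMap.smul_apply] at this
  · -- the reduction of an endomorphism of the deformed module is `A`-linear, hence a scalar
    have hg0 : ∀ x, coeff 0 (g x) = coeff 0 (g (const (coeff 0 x))) := fun x => by
      conv_lhs => rw [FormalSeries.eq_const_add k x]
      rw [map_add, map_smul, coeff_add, coeff_zero_X_smul, add_zero]
    let φ : E →ₗ[A] E :=
      { toFun := fun y => coeff 0 (g (const y))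
        map_add' := fun y z => by rw [const_add, map_add, coeff_add]
        map_smul' := fun a y => by
          have := congrArg (coeff 0) (hg (const y) (const a))
          rw [M.coeff_zero_act, hg0, M.coeff_zero_act] at this
          exact this }
    obtain ⟨a, ha⟩ := (Module.Invertible.toModuleEnd_bijective A E).2 φ
    refine ⟨a, hX _ fun x => ?_⟩
    have h1 : φ (coeff 0 x) = a • coeff 0 x := by rw [← ha]; rfl
    rw [LinearMap.sub_apply, coeff_sub, hL, hf, hg0, D'.aug_toAlg, coeff_zero_const]
    exact sub_eq_zero.2 h1
  · apply FaithfulSMul.eq_of_smul_eq_smul (α := E)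
    intro y
    have := hf (D'.toAlg a) (const y)
    rw [← hL, h, LinearMap.smul_apply, coeff_zero_X_smul, coeff_zero_const] at this
    rw [zero_smul, this, D'.aug_toAlg]

/-- The module deformation is obtained by transporting the right module `ê Dⁿ`, `ê = θ 1`, to
`E[[λ]]`; the left action is multiplication by the matrices `θ d`. -/
theorem Induces.isInducedBy [Module.Invertible A E] (b : DualBasis A E ι)
    (h : Induces b.gram D D') : IsInducedBy E D D' := by
  classical
  obtain ⟨θ, hθ⟩ := h
  have ha : (θ 1).map D.aug = b.gram := by rw [hθ, map_one, one_smul]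
  obtain ⟨β, hβ⟩ := b.exists_columnSpace_equiv (θ.map_one_mul 1) ha
  have hβ0 : ∀ w, coeff 0 (β.symm w) = ∑ i, D.aug ((w : ι → D.Alg) i) • b.vec i := fun w => by
    rw [← b.sum_smul (coeff 0 (β.symm w))]
    refine Finset.sum_congr rfl fun i _ => ?_
    rw [← hβ, β.apply_symm_apply]
  let R : FormalSeries E → FormalSeries A → columnSpace (θ 1) := fun x a =>
    ⟨_, mul_right_mem_columnSpace (β x).2 (D.toAlg a)⟩
  have hR : ∀ x a i, (R x a : ι → D.Alg) i = (β x : ι → D.Alg) i * D.toAlg a := fun _ _ _ => rfl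
  let M : ModuleDeformation D E :=
    { act := LinearMap.mk₂ k⟦X⟧ (fun x a => β.symm (R x a))
        (fun x y a => by
          rw [← map_add]; congr 1; ext i; simp [hR, add_mul])
        (fun p x a => by
          rw [← map_smul]; congr 1; ext i; simp [hR])
        (fun x a c => by
          rw [← map_add]; congr 1; ext i; simp [hR, mul_add])
        (fun p x a => by
          rw [← map_smul]; congr 1; ext i; simp [hR])
      act_mul := fun x a c => by
        simp only [LinearMap.mk₂_apply]
        congr 1; ext i
        simp only [hR, β.apply_symm_apply, D.toAlg_mul, mul_assoc]
      act_one := fun x => by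
        rw [LinearMap.mk₂_apply, β.symm_apply_eq]
        ext i
        rw [hR]
        exact mul_one _
      coeff_zero_act := fun x a => by
        rw [LinearMap.mk₂_apply, hβ0]
        simp only [hR, map_mul, hβ, D.aug_toAlg]
        conv_rhs => rw [← b.sum_smul (coeff 0 x), Finset.smul_sum]
        exact Finset.sum_congr rfl fun i _ => by rw [mul_comm, mul_smul] }
  have hM : ∀ x a, M.act x a = β.symm (R x a) := fun _ _ => rfl
  have hmem : ∀ d v, (θ d).mulVec v ∈ columnSpace (θ 1) := fun d v => by
    rw [mem_columnSpace, Matrix.mulVec_mulVec, θ.map_one_mul]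
  let ℓ : D'.Alg → FormalSeries E → FormalSeries E := fun d x => β.symm ⟨_, hmem d (β x)⟩
  have hℓ : ∀ d x, (β (ℓ d x) : ι → D.Alg) = (θ d).mulVec (β x) := fun d x => by
    simp only [ℓ, β.apply_symm_apply]
  have hinj : ∀ x y, (β x : ι → D.Alg) = β y → x = y := fun x y h => β.injective (Subtype.ext h)
  let f₀ : D'.Alg →ₗ[k⟦X⟧] Module.End k⟦X⟧ (FormalSeries E) := LinearMap.mk₂ k⟦X⟧ ℓ
    (fun d d' x => hinj _ _ (by
      simp only [hℓ, map_add, Submodule.coe_add, Matrix.add_mulVec]))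
    (fun p d x => hinj _ _ (by
      simp only [hℓ, map_smul, Submodule.coe_smul, Matrix.smul_mulVec]))
    (fun d x y => hinj _ _ (by
      simp only [hℓ, map_add, Submodule.coe_add, Matrix.mulVec_add]))
    (fun p d x => hinj _ _ (by
      simp only [hℓ, map_smul, Submodule.coe_smul, Matrix.mulVec_smul]))
  let f : D'.Alg →ₐ[k⟦X⟧] Module.End k⟦X⟧ (FormalSeries E) := AlgHom.ofLinearMap f₀
    (LinearMap.ext fun x => hinj _ _ ((hℓ 1 x).trans (mem_columnSpace.1 (β x).2)))
    (fun d d' => LinearMap.ext fun x => hinj _ _ (by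
      change (β (ℓ (d * d') x) : ι → D.Alg) = β (ℓ d (ℓ d' x))
      rw [hℓ, hℓ, hℓ, map_mul, Matrix.mulVec_mulVec]))
  have hf : ∀ d x, f d x = ℓ d x := fun _ _ => rfl
  refine isInducedBy_of_algHom M (f.codRestrict M.endAlg fun d x a => hinj _ _ ?_) fun d x => ?_
  · rw [hf, hf, hM, hM, hℓ, β.apply_symm_apply, β.apply_symm_apply]
    ext i
    rw [hR, hℓ]
    simp only [Matrix.mulVec, dotProduct, hR, Finset.sum_mul, mul_assoc]
  · change coeff 0 (β.symm ⟨_, hmem d (β x)⟩) = _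
    rw [hβ0]
    conv_rhs => rw [← b.sum_smul (coeff 0 x), Finset.smul_sum]
    refine Finset.sum_congr rfl fun i _ => ?_
    simp only [aug_mulVec, hθ, hβ, Matrix.smul_apply, smul_eq_mul, mul_assoc, ← Finset.mul_sum]
    rw [b.sum_gram_mul_fn, mul_smul]

/-- A dual basis of `E` lifts to a dual basis of the deformed right module, and `θ d` is the matrix of
the left action of `d` with respect to it. -/
theorem IsInducedBy.induces (b : DualBasis A E ι) (h : IsInducedBy E D D') :
    Induces b.gram D D' := by
  classical
  obtain ⟨M, j, hj⟩ := h
  obtain ⟨ê, hê, ha⟩ := D.exists_idempotent_lift b.gram_mul_gram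
  obtain ⟨β, hβ⟩ := b.exists_columnSpace_equiv hê ha
  let G : columnSpace ê →ₗ[k⟦X⟧] FormalSeries E :=
    (∑ i, (M.act (const (b.vec i))).comp
      (D.toAlg.symm.toLinearMap.comp (LinearMap.proj i))).comp (columnSpace ê).subtype
  have hG : ∀ v, G v = ∑ i, M.act (const (b.vec i)) (D.toAlg.symm ((v : ι → D.Alg) i)) :=
    fun v => by simp [G]
  have coeff_sum : ∀ g : ι → FormalSeries E, coeff 0 (∑ i, g i) = ∑ i, coeff 0 (g i) := fun g =>
    map_sum (⟨⟨coeff 0, rfl⟩, fun _ _ => rfl⟩ : FormalSeries E →+ E) g _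
  have hG0 : ∀ v, coeff 0 (G v) = ∑ i, D.aug ((v : ι → D.Alg) i) • b.vec i := fun v => by
    rw [hG, coeff_sum]
    simp only [M.coeff_zero_act, coeff_zero_const, D.coeff_zero_toAlg_symm]
  have hGβ : Function.Bijective (G ∘ β) :=
    bijective_of_coeff_zero (G.comp β.toLinearMap) fun z => by
    rw [LinearMap.comp_apply, hG0, LinearEquiv.coe_coe]
    simp only [hβ, b.sum_smul]
  have hGbij : Function.Bijective G := (Function.Bijective.of_comp_iff G β.bijective).1 hGβ
  let q : FormalSeries E ≃ₗ[k⟦X⟧] columnSpace ê := (LinearEquiv.ofBijective G hGbij).symm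
  have hGq : ∀ z, G (q z) = z := fun z => (LinearEquiv.ofBijective G hGbij).apply_symm_apply z
  have hq0 : ∀ z i, D.aug ((q z : ι → D.Alg) i) = b.fn i (coeff 0 z) := fun z i => by
    rw [b.aug_eq_fn_of_mem_columnSpace ha (q z).2, ← hG0, hGq]
  have hqact : ∀ z a i,
      (q (M.act z (D.toAlg.symm a)) : ι → D.Alg) i = (q z : ι → D.Alg) i * a := by
    intro z a
    have : q (M.act z (D.toAlg.symm a)) = ⟨_, mul_right_mem_columnSpace (q z).2 a⟩ := by
      apply hGbij.1
      rw [hGq, hG]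
      conv_lhs => rw [← hGq z, hG, map_sum, LinearMap.sum_apply]
      refine Finset.sum_congr rfl fun i _ => ?_
      rw [← M.act_mul]
      rfl
    intro i
    rw [this]
  let l : D'.Alg →ₐ[k⟦X⟧] Module.End k⟦X⟧ (FormalSeries E) := M.endAlg.val.comp j.toAlgHom
  have hl : ∀ d x a, l d (M.act x a) = M.act (l d x) a := fun d => (j d).2
  -- the matrix of an endomorphism with respect to the lifted dual basis
  have hcoord : ∀ d z i, (q (l d z) : ι → D.Alg) i =
      ∑ m, (q (l d (const (b.vec m))) : ι → D.Alg) i * (q z : ι → D.Alg) m := by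
    intro d z i
    conv_lhs => rw [← hGq z, hG, map_sum, map_sum, Submodule.coe_sum, Finset.sum_apply]
    exact Finset.sum_congr rfl fun m _ => by rw [hl, hqact]
  refine ⟨{ toFun := fun d => Matrix.of fun i m => (q (l d (const (b.vec m))) : ι → D.Alg) i
            map_smul' := fun p d => by ext i m; simp
            map_zero' := by ext i m; simp
            map_add' := fun d d' => by ext i m; simp
            map_mul' := fun d d' => ?_ }, fun d => ?_⟩
  · ext i m
    rw [Matrix.of_apply, map_mul, Module.End.mul_apply, hcoord, Matrix.mul_apply]
    rfl
  · ext i m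
    change D.aug ((q (l d (const (b.vec m))) : ι → D.Alg) i) = _
    rw [hq0]
    have h := hj (D'.toAlg.symm d) (const (b.vec m))
    rw [D'.toAlg.apply_symm_apply, D'.coeff_zero_toAlg_symm, coeff_zero_const] at h
    have h' : coeff 0 (l d (const (b.vec m))) = D'.aug d • b.vec m := h
    rw [h', map_smul]
    rfl

end ColumnSpace

/-! ### Invariance of the Poisson bracket -/

/-- Let `l a` and `r a` be the deformed left and right actions of `a ∈ A` on `E[[λ]]`.  They commute
and agree modulo `λ`, so `[l a, l b] + [r a, r b] = [l a - r a, l b - r b]` is divisible by `λ²`;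
its coefficient at `λ` is multiplication by the difference of the two Poisson brackets. -/
theorem IsInducedBy.poissonBracket_eq {E : Type*} [AddCommGroup E] [Module k E] [Module A E]
    [IsScalarTower k A E] [FaithfulSMul A E] {D D' : FormalDeformation k A}
    (h : IsInducedBy E D D') : D'.poissonBracket = D.poissonBracket := by
  obtain ⟨M, j, hj⟩ := h
  let l : D'.Alg →ₐ[k⟦X⟧] Module.End k⟦X⟧ (FormalSeries E) := M.endAlg.val.comp j.toAlgHom
  have hlr : ∀ d x a, l d (M.act x a) = M.act (l d x) a := fun d => (j d).2
  have hl0 : ∀ a x, coeff 0 (l (D'.toAlg a) x) = coeff 0 a • coeff 0 x := hj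
  have hX : ∀ y : FormalSeries E, coeff 1 ((X : k⟦X⟧) • y) = coeff 0 y :=
    fun y => coeff_succ_X_smul 0 y
  ext a b
  apply FaithfulSMul.eq_of_smul_eq_smul (α := E)
  intro y
  have hdiff : ∀ (a : A) (x : FormalSeries E), ∃ z,
      l (D'.toAlg (const a)) x - M.act x (const a) = (X : k⟦X⟧) • z := fun a x =>
    ⟨_, eq_X_smul_tail (by rw [coeff_sub, hl0, M.coeff_zero_act, sub_self])⟩
  choose δ hδ using hdiff
  let x : FormalSeries E := const y
  have hL : coeff 1 (l (D'.toAlg (D'.mul (const a) (const b) - D'.mul (const b) (const a))) x) =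
      D'.poissonBracket.bracket a b • y := by
    rw [eq_X_smul_tail (k := k) (D'.coeff_zero_commutator (const a) (const b)), map_smul, map_smul,
      LinearMap.smul_apply, hX, hl0, coeff_tail, zero_add, D'.coeff_one_commutator]
    rfl
  have hR : coeff 1 (M.act x (D.mul (const a) (const b) - D.mul (const b) (const a))) =
      D.poissonBracket.bracket a b • y := by
    rw [eq_X_smul_tail (k := k) (D.coeff_zero_commutator (const a) (const b)), map_smul, hX,
      M.coeff_zero_act, coeff_tail, zero_add, D.coeff_one_commutator]
    rfl
  rw [← hL, ← hR, ← sub_eq_zero, ← coeff_sub]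
  have key : l (D'.toAlg (D'.mul (const a) (const b) - D'.mul (const b) (const a))) x -
      M.act x (D.mul (const a) (const b) - D.mul (const b) (const a)) =
      (X : k⟦X⟧) • (X : k⟦X⟧) • (δ a (δ b x) - δ b (δ a x)) := by
    have h2 : ∀ a b, (X : k⟦X⟧) • (X : k⟦X⟧) • δ a (δ b x) =
        l (D'.toAlg (const a)) (l (D'.toAlg (const b)) x - M.act x (const b)) -
          M.act (l (D'.toAlg (const b)) x - M.act x (const b)) (const a) := fun a b => by
      rw [← hδ a (δ b x), smul_sub, ← map_smul (l _), ← LinearMap.smul_apply, ← map_smul M.act,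
        ← hδ b x]
    rw [smul_sub, smul_sub, h2, h2]
    simp only [map_sub, D'.toAlg_mul, map_mul, LinearMap.sub_apply, Module.End.mul_apply,
      M.act_mul, hlr]
    abel
  rw [key, hX, coeff_zero_X_smul]

/-! ### The action of the Picard group -/

section Action

variable {A : Type u} [CommRing A] [Algebra k A]

/-- The idempotents of two dual bases of isomorphic invertible modules induce the same relation. -/
theorem Induces.of_equiv {E E' ι κ : Type*} [AddCommGroup E] [Module A E] [Module.Invertible A E]
    [AddCommGroup E'] [Module A E'] [Fintype ι] [Fintype κ] (b : DualBasis A E ι)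
    (b' : DualBasis A E' κ) (φ : E ≃ₗ[A] E') {D D' : FormalDeformation k A}
    (h : Induces b.gram D D') : Induces b'.gram D D' := by
  have : Module.Invertible A E' := .congr φ
  let : Module k E' := Module.compHom E' (algebraMap k A)
  have : IsScalarTower k A E' := IsScalarTower.of_algebraMap_smul fun _ _ => rfl
  rw [← b.gram_map φ] at h
  exact (h.isInducedBy (b.map φ)).induces b'

namespace CommRing.Pic

/-- A chosen dual basis of a representative of a class in the Picard group. -/
noncomputable def dualBasis (P : Pic A) :
    DualBasis A P (Fin ((DualBasis.exists_fin A P).choose + 1)) :=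
  (DualBasis.exists_fin A P).choose_spec.some

variable (k) in
theorem exists_actDefa (P : Pic A) (q : Defa k A) :
    ∃ q' : Defa k A, ∃ D D' : FormalDeformation k A,
      D.toDefa = q ∧ D'.toDefa = q' ∧ Induces P.dualBasis.gram D D' := by
  obtain ⟨D, rfl⟩ := Quotient.exists_rep q
  obtain ⟨D', h⟩ := Induces.exists_induces P.dualBasis.isRankOneIdempotent D
  exact ⟨_, D, D', rfl, rfl, h⟩

variable (k) in
/-- The action of a class in the Picard group on equivalence classes of deformations. -/
noncomputable def actDefa (P : Pic A) (q : Defa k A) : Defa k A := (exists_actDefa k P q).choose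

theorem _root_.FormalDeformation.toDefa_eq_iff {D D' : FormalDeformation k A} :
    D.toDefa = D'.toDefa ↔ D.Equivalent D' :=
  Quotient.eq (r := FormalDeformation.setoid k A)

theorem actDefa_eq_iff (P : Pic A) (D D' : FormalDeformation k A) :
    actDefa k P D.toDefa = D'.toDefa ↔ Induces P.dualBasis.gram D D' := by
  obtain ⟨D₁, D₁', h₁, h₁', h⟩ := (exists_actDefa k P D.toDefa).choose_spec
  change D₁'.toDefa = actDefa k P D.toDefa at h₁'
  have hD := h.congr_left (FormalDeformation.toDefa_eq_iff.1 h₁)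
  rw [← h₁', FormalDeformation.toDefa_eq_iff]
  exact ⟨fun h' => hD.congr_right h', fun h' => hD.equivalent P.dualBasis.isRankOneIdempotent h'⟩

variable (k A) in
/-- The action of the Picard group on equivalence classes of deformations. -/
noncomputable def actDefaHom : Pic A →* Equiv.Perm (Defa k A) :=
  MonoidHom.toHomPerm
    { toFun := actDefa k
      map_one' := by
        refine funext fun q => ?_
        obtain ⟨D, rfl⟩ := Quotient.exists_rep q
        refine (actDefa_eq_iff 1 D D).2 ?_
        have φ : A ≃ₗ[A] (1 : Pic A) :=
          (Pic.mk.linearEquiv A A).symm.trans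
            (Pic.ext_iff.1 (by rw [Pic.mk_self])).some
        refine Induces.of_equiv (DualBasis.self A) _ φ ?_
        rw [DualBasis.gram_self]
        exact Induces.refl D
      map_mul' := fun P Q => by
        refine funext fun q => ?_
        obtain ⟨D, rfl⟩ := Quotient.exists_rep q
        obtain ⟨D', h⟩ := Quotient.exists_rep (actDefa k Q D.toDefa)
        obtain ⟨D'', h'⟩ := Quotient.exists_rep (actDefa k P D'.toDefa)
        change actDefa k (P * Q) D.toDefa = actDefa k P (actDefa k Q D.toDefa)
        change D'.toDefa = _ at h
        change D''.toDefa = _ at h'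
        rw [← h, ← h', actDefa_eq_iff]
        rw [eq_comm, actDefa_eq_iff] at h h'
        have φ : TensorProduct A P Q ≃ₗ[A] (P * Q : Pic A) :=
          (Pic.mk_eq_iff.1 (Pic.mul_eq_tensor P Q).symm).some
        refine Induces.of_equiv (P.dualBasis.tensor Q.dualBasis) _ φ ?_
        rw [DualBasis.gram_tensor]
        exact h'.trans h }

theorem actDefaHom_eq_iff {E ι : Type*} [AddCommGroup E] [Module A E] [Module.Invertible A E]
    [Fintype ι] (b : DualBasis A E ι) (D D' : FormalDeformation k A) :
    actDefaHom k A (Pic.mk A E) D.toDefa = D'.toDefa ↔ Induces b.gram D D' := by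
  have φ : Pic.mk A E ≃ₗ[A] E := Pic.mk.linearEquiv A E
  change actDefa k _ _ = _ ↔ _
  rw [actDefa_eq_iff]
  exact ⟨fun h => h.of_equiv _ _ φ, fun h => h.of_equiv _ _ φ.symm⟩

theorem actDefaHom_eq_iff_isInducedBy (E : Type*) [AddCommGroup E] [Module k E] [Module A E]
    [IsScalarTower k A E] [Module.Invertible A E] (D D' : FormalDeformation k A) :
    actDefaHom k A (Pic.mk A E) D.toDefa = D'.toDefa ↔ IsInducedBy E D D' := by
  obtain ⟨n, ⟨b⟩⟩ := DualBasis.exists_fin A E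
  rw [actDefaHom_eq_iff b]
  exact ⟨fun h => h.isInducedBy b, fun h => h.induces b⟩

theorem poissonBracket_eq_of_actDefaHom (P : Pic A) (D D' : FormalDeformation k A)
    (h : actDefaHom k A P D.toDefa = D'.toDefa) : D'.poissonBracket = D.poissonBracket := by
  let : Module k P := Module.compHom P (algebraMap k A)
  have : IsScalarTower k A P := IsScalarTower.of_algebraMap_smul fun _ _ => rfl
  rw [← Pic.mk_eq_self (M := P), actDefaHom_eq_iff_isInducedBy] at h
  exact h.poissonBracket_eq

end CommRing.Pic

end Action

end Deformation

/-! ### A criterion for invertibility of a module -/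

open TensorProduct in
/-- A module over a commutative ring which is a generator and whose endomorphisms commute is
invertible.  Commutation of the rank one operators `f ⊗ x` and `g ⊗ y` gives
`g z ^ 2 • (f y • x - f x • y) = 0` for all `g` and `z`; as the elements `g z` generate the unit
ideal, `f y • x = f x • y`, and then `g ⊗ y` is a multiple of `∑ f i ⊗ x i`. -/
theorem Module.Invertible.of_sum_eq_one {A E ι : Type*} [CommRing A] [AddCommGroup E] [Module A E]
    [Fintype ι] (x : ι → E) (f : ι → Module.Dual A E) (h1 : ∑ i, f i (x i) = 1)
    (hcomm : ∀ φ ψ : Module.End A E, φ * ψ = ψ * φ) : Module.Invertible A E := by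
  have h2 : ∀ (g h : Module.Dual A E) (x y z : E),
      (g z * h y) • x = (h z * g x) • y := by
    intro g h x y z
    have := LinearMap.congr_fun (hcomm (h.smulRight x) (g.smulRight y)) z
    simpa [mul_smul] using this
  have h3 : ∀ (g h : Module.Dual A E) (x y z : E),
      (g z * g z) • (h y • x - h x • y) = 0 := by
    intro g h x y z
    have e1 := congrArg g (h2 g h z x z)
    simp only [map_smul, smul_eq_mul] at e1
    have e2 := congrArg (fun w => g z • w) (h2 g h x y z)
    simp only [smul_smul] at e2
    rw [smul_sub, sub_eq_zero, smul_smul, smul_smul, mul_assoc, e2]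
    congr 1
    linear_combination -e1
  have h4 : ∀ (h : Module.Dual A E) (x y : E), h y • x = h x • y := by
    intro h y z
    rw [← sub_eq_zero]
    set w := h z • y - h y • z with hw
    have hrad : (1 : A) ∈ Ideal.radical (LinearMap.ker (LinearMap.toSpanSingleton A E w)) := by
      rw [← h1]
      refine Ideal.sum_mem _ fun i _ => ⟨2, ?_⟩
      rw [LinearMap.mem_ker, LinearMap.toSpanSingleton_apply, pow_two]
      exact h3 (f i) h y z (x i)
    obtain ⟨n, hn⟩ := hrad
    rwa [one_pow, LinearMap.mem_ker, LinearMap.toSpanSingleton_apply, one_smul] at hn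
  have h5 : ∀ t : Module.Dual A E ⊗[A] E, t = contractLeft A E t • ∑ i, f i ⊗ₜ x i := by
    intro t
    induction t with
    | zero => simp
    | add t t' ht ht' => rw [map_add, add_smul, ← ht, ← ht']
    | tmul g y =>
      rw [contractLeft_apply, Finset.smul_sum]
      conv_lhs => rw [← one_smul A y, ← h1, Finset.sum_smul, tmul_sum]
      refine Finset.sum_congr rfl fun i _ => ?_
      rw [h4 (f i), ← smul_tmul, smul_tmul']
      congr 1
      ext z
      have := congrArg g (h4 (f i) z y)
      simp only [map_smul, smul_eq_mul] at this
      simp [this, mul_comm]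
  refine ⟨⟨?_, fun a => ⟨a • ∑ i, f i ⊗ₜ x i, by simp [h1]⟩⟩⟩
  rw [injective_iff_map_eq_zero]
  intro t ht
  rw [h5 t, ht, zero_smul]

/-- An invertible module is a generator. -/
theorem Module.Invertible.exists_sum_eq_one (A E : Type*) [CommRing A] [AddCommGroup E] [Module A E]
    [Module.Invertible A E] :
    ∃ s : Finset (Module.Dual A E × E), ∑ p ∈ s, p.1 p.2 = 1 := by
  obtain ⟨t, ht⟩ := (Module.Invertible.bijective (R := A) (M := E)).2 1
  obtain ⟨s, rfl⟩ := TensorProduct.exists_finset t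
  exact ⟨s, by simpa using ht⟩

/-! ### Morita equivalence of a ring with a full corner -/

section Corner

open CategoryTheory

variable {K : Type v} [CommRing K] {R S : Type u} [Ring R] [Ring S] [Algebra K R] [Algebra K S]

/-- The module `e N` over `S` obtained from an `R`-module `N` and a non-unital homomorphism
`θ : S → R` with `e = θ 1`. -/
def CornerModule (θ : S →ₙₐ[K] R) (N : Type*) [AddCommGroup N] [Module R N] : AddSubgroup N where
  carrier := {x | θ 1 • x = x}
  zero_mem' := smul_zero _
  add_mem' {x y} hx hy := by
    change θ 1 • (x + y) = x + y
    rw [smul_add, hx, hy]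
  neg_mem' {x} hx := by
    change θ 1 • (-x) = -x
    rw [smul_neg, hx]

namespace CornerModule

variable (θ : S →ₙₐ[K] R) {N N' : Type*} [AddCommGroup N] [Module R N] [AddCommGroup N']
  [Module R N']

theorem smul_coe (x : CornerModule θ N) : θ 1 • (x : N) = x := x.2

theorem smul_mem (s : S) (x : N) : θ s • x ∈ CornerModule θ N := by
  change θ 1 • θ s • x = θ s • x
  rw [smul_smul, θ.map_one_mul]

instance : Module S (CornerModule θ N) where
  smul s x := ⟨θ s • (x : N), smul_mem θ s (x : N)⟩
  one_smul x := Subtype.ext x.2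
  mul_smul s t x := Subtype.ext (by
    change θ (s * t) • (x : N) = θ s • θ t • (x : N)
    rw [map_mul, mul_smul])
  smul_zero s := Subtype.ext (smul_zero (θ s))
  smul_add s x y := Subtype.ext (smul_add (θ s) (x : N) y)
  add_smul s t x := Subtype.ext (by
    change θ (s + t) • (x : N) = θ s • (x : N) + θ t • (x : N)
    rw [map_add, add_smul])
  zero_smul x := Subtype.ext (by
    change θ 0 • (x : N) = 0
    rw [map_zero, zero_smul])

theorem coe_smul (s : S) (x : CornerModule θ N) :
    ((s • x : CornerModule θ N) : N) = θ s • (x : N) :=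
  rfl

/-- The restriction of a linear map to corner modules. -/
def map (f : N →ₗ[R] N') : CornerModule θ N →ₗ[S] CornerModule θ N' where
  toFun x := ⟨f (x : N), by
    change θ 1 • f (x : N) = f (x : N)
    rw [← map_smul, smul_coe]⟩
  map_add' x y := Subtype.ext (map_add f (x : N) y)
  map_smul' s x := Subtype.ext (f.map_smul (θ s) (x : N))

/-- The functor `N ↦ e N`. -/
def functor : ModuleCat.{u} R ⥤ ModuleCat.{u} S where
  obj N := ModuleCat.of S (CornerModule θ N)
  map f := ModuleCat.ofHom (map θ f.hom)

open scoped ModuleCat.Algebra in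
instance : (functor θ).Linear K where
  map_smul {N N'} f c := by
    ext (x : CornerModule θ N)
    apply Subtype.ext
    change algebraMap K R c • (f.hom (x : N)) = θ (algebraMap K S c) • f.hom (x : N)
    have hx : f.hom (x : N) = θ 1 • f.hom (x : N) := by rw [← map_smul, smul_coe]
    conv_lhs => rw [hx]
    rw [Algebra.algebraMap_eq_smul_one, Algebra.algebraMap_eq_smul_one, map_smul, smul_smul,
      smul_mul_assoc, one_mul]

section Full

variable {θ} {κ : Type*} [Fintype κ] {p q : κ → R}

theorem sum_smul_smul (hpq : ∑ l, p l * θ 1 * q l = 1) (x : N) :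
    ∑ l, p l • θ 1 • q l • x = x := by
  simp only [smul_smul, ← Finset.sum_smul, ← mul_assoc, hpq, one_smul]

/-- The functor `N ↦ e N` is faithful when `e` is full. -/
theorem map_injective (hpq : ∑ l, p l * θ 1 * q l = 1) {f g : N →ₗ[R] N'}
    (h : map θ f = map θ g) : f = g := by
  ext x
  rw [← sum_smul_smul hpq x, map_sum, map_sum]
  refine Finset.sum_congr rfl fun l _ => ?_
  rw [map_smul f, map_smul g]
  congr 1
  exact congrArg Subtype.val (LinearMap.congr_fun h ⟨_, smul_mem θ 1 (q l • x)⟩)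

/-- The functor `N ↦ e N` is full when `e` is full: an `S`-linear map `g` on corners is the
restriction of `x ↦ ∑ p l • g (e q l x)`. -/
theorem map_surjective (hpq : ∑ l, p l * θ 1 * q l = 1)
    (hθ : ∀ r, ∃ s, θ s = θ 1 * r * θ 1) (g : CornerModule θ N →ₗ[S] CornerModule θ N') :
    ∃ f : N →ₗ[R] N', map θ f = g := by
  let c : R → N → CornerModule θ N := fun r x => ⟨θ 1 • r • x, smul_mem θ 1 _⟩
  -- `g` is linear over the corner ring
  have hg : ∀ (r : R) (x : CornerModule θ N), (g (c r x) : N') = θ 1 • r • (g x : N') := by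
    intro r x
    obtain ⟨s, hs⟩ := hθ r
    have : c r x = s • x := Subtype.ext (by
      rw [coe_smul, hs, mul_smul, mul_smul, smul_coe])
    rw [this, map_smul, coe_smul, hs, mul_smul, mul_smul, smul_coe]
  have hc : ∀ r x, c r x = ∑ l, c (r * p l) (c (q l) x) := fun r x => Subtype.ext (by
    rw [AddSubgroup.val_finsetSum]
    simp only [c, mul_smul, ← Finset.smul_sum, sum_smul_smul hpq])
  let f : N →ₗ[R] N' :=
    { toFun := fun x => ∑ l, p l • (g (c (q l) x) : N')
      map_add' := fun x y => by
        rw [← Finset.sum_add_distrib]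
        refine Finset.sum_congr rfl fun l _ => ?_
        rw [← smul_add, ← AddSubgroup.coe_add, ← map_add]
        congr 3
        exact Subtype.ext (by simp [c])
      map_smul' := fun r x => by
        have : ∀ l, c (q l) (r • x) = c (q l * r) x := fun l => Subtype.ext (by simp [c, mul_smul])
        simp only [this, RingHom.id_apply]
        conv_lhs =>
          enter [2, l]
          rw [hc (q l * r) x, map_sum, AddSubgroup.val_finsetSum]
          enter [2, 2, m]
          rw [hg, mul_smul, mul_smul]
        simp only [← Finset.smul_sum, sum_smul_smul hpq] }
  refine ⟨f, LinearMap.ext fun x => Subtype.ext ?_⟩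
  change ∑ l, p l • (g (c (q l) x) : N') = g x
  simp only [hg, sum_smul_smul hpq]

end Full

/-- The `R`-module of additive maps `h : R → N` with `h (θ s * r) = s • h r`, that is
`Hom_S (e R, N)`; it is the image of the `S`-module `N` under the inverse of `N ↦ e N`. -/
def Coinduced (N : Type*) [AddCommGroup N] [Module S N] : AddSubgroup (R →+ N) where
  carrier := {h | ∀ s r, h (θ s * r) = s • h r}
  zero_mem' s r := (smul_zero s).symm
  add_mem' {h h'} hh hh' s r := by
    rw [AddMonoidHom.add_apply, AddMonoidHom.add_apply, hh, hh', smul_add]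
  neg_mem' {h} hh s r := by
    rw [AddMonoidHom.neg_apply, AddMonoidHom.neg_apply, hh, smul_neg]

instance (N : Type*) [AddCommGroup N] [Module S N] : Module R (Coinduced θ N) where
  smul r h := ⟨(h : R →+ N).comp (AddMonoidHom.mulRight r), fun s x => by
    simp only [AddMonoidHom.comp_apply, AddMonoidHom.mulRight_apply, mul_assoc]
    exact h.2 s _⟩
  one_smul h := Subtype.ext (AddMonoidHom.ext fun x => congrArg (h : R →+ N) (mul_one x))
  mul_smul r r' h := Subtype.ext (AddMonoidHom.ext fun x =>
    congrArg (h : R →+ N) (mul_assoc x r r').symm)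
  smul_zero r := rfl
  smul_add r h h' := rfl
  add_smul r r' h := Subtype.ext (AddMonoidHom.ext fun x => by
    change (h : R →+ N) (x * (r + r')) = (h : R →+ N) (x * r) + (h : R →+ N) (x * r')
    rw [mul_add, map_add])
  zero_smul h := Subtype.ext (AddMonoidHom.ext fun x => by
    change (h : R →+ N) (x * 0) = 0
    rw [mul_zero, map_zero])

theorem Coinduced.smul_apply (N : Type*) [AddCommGroup N] [Module S N] (r : R) (h : Coinduced θ N)
    (x : R) : ((r • h : Coinduced θ N) : R →+ N) x = (h : R →+ N) (x * r) := rfl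

variable {θ} in
/-- Every `S`-module is a corner module. -/
theorem exists_equiv (hinj : Function.Injective θ) (hθ : ∀ r, ∃ s, θ s = θ 1 * r * θ 1)
    (N : Type*) [AddCommGroup N] [Module S N] :
    Nonempty (CornerModule θ (Coinduced θ N) ≃ₗ[S] N) := by
  choose c hc using hθ
  have hc1 : c (θ 1) = 1 := hinj (by rw [hc, θ.map_one_mul, θ.map_one_mul])
  have hl : ∀ s r, c (θ s * r) = s * c r := fun s r => hinj (by
    rw [hc, map_mul, hc, ← mul_assoc, θ.map_one_mul, ← mul_assoc, ← mul_assoc, θ.mul_map_one])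
  have hadd : ∀ r r', c (r + r') = c r + c r' := fun r r' => hinj (by
    rw [hc, map_add, hc, hc, mul_add, add_mul])
  -- an element fixed by `e` is determined by its value at `e`
  have hfix : ∀ (h : CornerModule θ (Coinduced θ N)) (r : R),
      ((h : Coinduced θ N) : R →+ N) r = c r • ((h : Coinduced θ N) : R →+ N) (θ 1) := by
    intro h r
    have e1 : ∀ x, ((h : Coinduced θ N) : R →+ N) (x * θ 1) = ((h : Coinduced θ N) : R →+ N) x :=
      fun x => by rw [← Coinduced.smul_apply, smul_coe]
    have e2 := (h : Coinduced θ N).2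
    rw [← e2, hc, mul_assoc, mul_assoc, e2, one_smul, θ.map_one_mul, e1]
  refine ⟨{ toFun := fun h => ((h : Coinduced θ N) : R →+ N) (θ 1)
            map_add' := fun h h' => rfl
            map_smul' := fun s h => ?_
            invFun := fun n => ⟨⟨⟨⟨fun r => c r • n, ?_⟩, fun r r' => ?_⟩, fun s r => ?_⟩, ?_⟩
            left_inv := fun h => ?_
            right_inv := fun n => ?_ }⟩
  · rw [coe_smul, Coinduced.smul_apply, RingHom.id_apply, θ.map_one_mul, ← (h : Coinduced θ N).2,
      θ.mul_map_one]
  · have : c 0 = 0 := hinj (by rw [hc, map_zero, mul_zero, zero_mul])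
    rw [this, zero_smul]
  · change c (r + r') • n = c r • n + c r' • n
    rw [hadd, add_smul]
  · change c (θ s * r) • n = s • c r • n
    rw [hl, mul_smul]
  · refine Subtype.ext (AddMonoidHom.ext fun r => ?_)
    change c (r * θ 1) • n = c r • n
    congr 1
    exact hinj (by rw [hc, hc, mul_assoc, mul_assoc, θ.map_one_mul, mul_assoc])
  · exact Subtype.ext (Subtype.ext (AddMonoidHom.ext fun r => (hfix h r).symm))
  · change c (θ 1) • n = n
    rw [hc1, one_smul]

end CornerModule

open scoped ModuleCat.Algebra in
/-- A ring is Morita equivalent to each of its full corners `e R e`, `R e R = R`. -/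
theorem IsMoritaEquivalent.of_full_corner (θ : S →ₙₐ[K] R)
    (hinj : Function.Injective θ) (hθ : ∀ r, ∃ s, θ s = θ 1 * r * θ 1)
    {κ : Type*} [Fintype κ] (p q : κ → R)
    (hpq : ∑ l, p l * θ 1 * q l = 1) : IsMoritaEquivalent K R S := by
  have : (CornerModule.functor θ).Faithful :=
    ⟨fun h => ModuleCat.hom_ext (CornerModule.map_injective hpq (congrArg ModuleCat.Hom.hom h))⟩
  have : (CornerModule.functor θ).Full := ⟨fun g => by
    obtain ⟨f, hf⟩ := CornerModule.map_surjective hpq hθ g.hom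
    exact ⟨ModuleCat.ofHom f, ModuleCat.hom_ext hf⟩⟩
  have : (CornerModule.functor θ).EssSurj := ⟨fun N =>
    ⟨ModuleCat.of R (CornerModule.Coinduced θ N),
      ⟨(CornerModule.exists_equiv hinj hθ N).some.toModuleIso⟩⟩⟩
  have : (CornerModule.functor θ).IsEquivalence := {}
  exact ⟨⟨{ eqv := (CornerModule.functor θ).asEquivalence
            linear := inferInstanceAs ((CornerModule.functor θ).Linear K) }⟩⟩

end Corner

/-! ### The matrix form of a Morita equivalence -/

section Morita

open CategoryTheory

variable {K : Type v} [CommRing K] {R S : Type u} [Ring R] [Ring S] [Algebra K R] [Algebra K S]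

theorem ModuleCat.isSeparator_self (R : Type u) [Ring R] : IsSeparator (ModuleCat.of R R) := by
  rw [isSeparator_def]
  intro M N f g h
  ext (x : M)
  have := LinearMap.congr_fun
    (congrArg ModuleCat.Hom.hom (h (ModuleCat.ofHom (LinearMap.toSpanSingleton R M x)))) 1
  simpa using this

/-- The ring is a retract of a finite power of any separator of its module category. -/
theorem ModuleCat.exists_sum_comp_eq_id {Y : ModuleCat.{u} R} (hY : IsSeparator Y) :
    ∃ (n : ℕ) (y : Fin n → (ModuleCat.of R R ⟶ Y)) (g : Fin n → (Y ⟶ ModuleCat.of R R)),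
      ∑ i, y i ≫ g i = 𝟙 _ := by
  let s : Set R := {r | ∃ (g : Y →ₗ[R] R) (y : Y), g y = r}
  -- the trace ideal of a separator is the whole ring
  have hs : Submodule.span R s = ⊤ := by
    have h0 : ModuleCat.ofHom (Submodule.span R s).mkQ = 0 := by
      refine hY.def _ _ fun h => ?_
      ext y
      have : h.hom y ∈ Submodule.span R s := Submodule.subset_span ⟨h.hom, y, rfl⟩
      simpa using this
    have h1 : (Submodule.span R s).mkQ = 0 := congrArg ModuleCat.Hom.hom h0
    rw [← Submodule.ker_mkQ (Submodule.span R s), h1, LinearMap.ker_zero]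
  have h1 : (1 : R) ∈ Submodule.span R s := hs ▸ Submodule.mem_top
  obtain ⟨n, c, t, h⟩ := Submodule.mem_span_set'.1 h1
  choose g y hgy using fun i => (t i).2
  refine ⟨n, fun i => ModuleCat.ofHom (LinearMap.toSpanSingleton R Y (c i • y i)),
    fun i => ModuleCat.ofHom (g i), ?_⟩
  apply ModuleCat.hom_ext
  rw [ModuleCat.hom_sum]
  refine LinearMap.ext_ring ?_
  rw [LinearMap.sum_apply]
  simp only [ModuleCat.hom_comp, ModuleCat.hom_ofHom, LinearMap.comp_apply,
    LinearMap.toSpanSingleton_apply, one_smul, map_smul, hgy, h]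
  rfl

namespace ModuleCat

/-- Right multiplication by `r`, as an endomorphism of the left module `R`. -/
def rightMul (r : R) : of R R ⟶ of R R := ofHom (LinearMap.toSpanSingleton R R r)

/-- The element `r` of which an endomorphism of the left module `R` is the right multiplication. -/
def toElem (φ : of R R ⟶ of R R) : R := φ.hom 1

theorem rightMul_toElem (φ : of R R ⟶ of R R) : rightMul (toElem φ) = φ := by
  apply hom_ext
  refine LinearMap.ext_ring ?_
  exact one_smul R (φ.hom (1 : R))

theorem toElem_rightMul (r : R) : toElem (rightMul r) = r := one_smul R r

theorem toElem_comp (φ ψ : of R R ⟶ of R R) : toElem (φ ≫ ψ) = toElem φ * toElem ψ := by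
  conv_lhs => rw [← rightMul_toElem ψ]
  rfl

theorem toElem_id : toElem (𝟙 (of R R)) = 1 := rfl

theorem toElem_injective : Function.Injective (toElem (R := R)) := fun φ ψ h => by
  rw [← rightMul_toElem φ, h, rightMul_toElem]

theorem toElem_sum {ι : Type*} (s : Finset ι) (φ : ι → (of R R ⟶ of R R)) :
    toElem (∑ i ∈ s, φ i) = ∑ i ∈ s, toElem (φ i) := by
  rw [toElem, hom_sum, LinearMap.sum_apply]
  rfl

theorem toElem_add (φ ψ : of R R ⟶ of R R) : toElem (φ + ψ) = toElem φ + toElem ψ := rfl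

theorem rightMul_mul (r r' : R) : rightMul (r * r') = rightMul r ≫ rightMul r' :=
  toElem_injective (by rw [toElem_comp, toElem_rightMul, toElem_rightMul, toElem_rightMul])

theorem rightMul_one : rightMul (1 : R) = 𝟙 _ :=
  toElem_injective (by rw [toElem_rightMul, toElem_id])

theorem rightMul_add (r r' : R) : rightMul (r + r') = rightMul r + rightMul r' :=
  toElem_injective (by rw [toElem_add, toElem_rightMul, toElem_rightMul, toElem_rightMul])

open scoped ModuleCat.Algebra in
/-- A `K`-linear functor preserves the relation `g = c • f`, expressed elementwise. -/
theorem map_hom_eq_smul (F : ModuleCat.{u} R ⥤ ModuleCat.{u} S) [F.Linear K] {M N : ModuleCat.{u} R}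
    {f g : M ⟶ N} {c : K} (h : ∀ x, g.hom x = algebraMap K R c • f.hom x) (x : F.obj M) :
    (F.map g).hom x = algebraMap K S c • (F.map f).hom x := by
  have hg : g = c • f := hom_ext (LinearMap.ext h)
  rw [hg, F.map_smul]
  rfl

end ModuleCat

open ModuleCat in
open scoped ModuleCat.Algebra in
/-- A Morita equivalence `F` identifies `R` with a full corner of a matrix ring over `S`: as `F R`
is a retract of `Sⁿ`, the matrices of the endomorphisms `F (· r)` define a non-unital
homomorphism. -/
theorem IsMoritaEquivalent.exists_matrix (h : IsMoritaEquivalent K R S) :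
    ∃ (n : ℕ) (θ : R →ₙₐ[K] Matrix (Fin n) (Fin n) S), Function.Injective θ ∧
      (∀ B, ∃ r, θ r = θ 1 * B * θ 1) ∧
      ∃ (m : ℕ) (a b : Fin m → Fin n → S), (∀ l, Matrix.vecMul (a l) (θ 1) = a l) ∧
        ∑ l, ∑ j, a l j * b l j = 1 := by
  obtain ⟨⟨e⟩⟩ := h
  let F := e.eqv.functor
  obtain ⟨n, y, g, hyg⟩ := exists_sum_comp_eq_id ((isSeparator_self S).of_equivalence e.eqv.symm)
  obtain ⟨m, t, w, htw⟩ := exists_sum_comp_eq_id ((isSeparator_self R).of_equivalence e.eqv)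
  let s : Fin n → (F.obj (of R R) ⟶ of S S) := fun i => F.map (y i) ≫ e.eqv.counit.app _
  let r : Fin n → (of S S ⟶ F.obj (of R R)) := fun i => e.eqv.counitInv.app _ ≫ F.map (g i)
  have hsr : ∑ i, s i ≫ r i = 𝟙 _ := by
    rw [← F.map_id, ← hyg, F.map_sum]
    refine Finset.sum_congr rfl fun i _ => ?_
    simp [s, r, F]
  have hins : ∀ {M N : ModuleCat.{u} S} (f : M ⟶ F.obj (of R R)) (f' : F.obj (of R R) ⟶ N),
      ∑ i, (f ≫ s i) ≫ (r i ≫ f') = f ≫ f' := by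
    intro M N f f'
    have : ∀ i, (f ≫ s i) ≫ (r i ≫ f') = (f ≫ (s i ≫ r i)) ≫ f' := fun i => by
      simp only [Category.assoc]
    simp only [this]
    rw [← Preadditive.sum_comp, ← Preadditive.comp_sum, hsr, Category.comp_id]
  let θ : R →ₙₐ[K] Matrix (Fin n) (Fin n) S :=
    { toFun := fun x => Matrix.of fun i j => toElem ((r i ≫ F.map (rightMul x)) ≫ s j)
      map_smul' := fun c x => by
        ext i j
        have h : ∀ z : R, (rightMul (c • x)).hom z = algebraMap K R c • (rightMul x).hom z :=
          fun z => (mul_smul_comm c z x).trans (Algebra.smul_def c (z * x))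
        change (s j).hom ((F.map (rightMul (c • x))).hom ((r i).hom (1 : S))) =
          c • toElem ((r i ≫ F.map (rightMul x)) ≫ s j)
        rw [map_hom_eq_smul F h, map_smul, Algebra.smul_def]
        rfl
      map_add' := fun x x' => by
        ext i j
        simp only [Matrix.of_apply, rightMul_add, F.map_add, Preadditive.comp_add,
          Preadditive.add_comp, toElem_add, Matrix.add_apply]
      map_zero' := by
        ext i j
        have h0 : rightMul (0 : R) = 0 := toElem_injective (toElem_rightMul _)
        rw [Matrix.of_apply, h0, F.map_zero, Limits.comp_zero, Limits.zero_comp]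
        rfl
      map_mul' := fun x x' => by
        ext i j
        simp only [Matrix.of_apply, Matrix.mul_apply, ← toElem_comp, ← toElem_sum, rightMul_mul,
          F.map_comp]
        congr 1
        have := hins (r i ≫ F.map (rightMul x)) (F.map (rightMul x') ≫ s j)
        simp only [Category.assoc] at this ⊢
        exact this.symm }
  have hθ : ∀ x i j, θ x i j = toElem ((r i ≫ F.map (rightMul x)) ≫ s j) := fun _ _ _ => rfl
  have hθ1 : ∀ i j, θ 1 i j = toElem (r i ≫ s j) := fun i j => by
    rw [hθ, rightMul_one, F.map_id, Category.comp_id]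
  refine ⟨n, θ, fun x x' hx => ?_, fun B => ?_, m, fun l j => toElem (t l ≫ s j),
    fun l j => toElem (r j ≫ w l), fun l => ?_, ?_⟩
  · have h1 : ∀ i j, (r i ≫ F.map (rightMul x)) ≫ s j = (r i ≫ F.map (rightMul x')) ≫ s j :=
      fun i j => toElem_injective (congrFun (congrFun hx i) j)
    have h2 : ∀ j, F.map (rightMul x) ≫ s j = F.map (rightMul x') ≫ s j := fun j => by
      rw [← Category.id_comp (F.map (rightMul x) ≫ s j),
        ← Category.id_comp (F.map (rightMul x') ≫ s j), ← hins _ (F.map (rightMul x) ≫ s j),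
        ← hins _ (F.map (rightMul x') ≫ s j)]
      refine Finset.sum_congr rfl fun i _ => ?_
      rw [← Category.assoc (r i), ← Category.assoc (r i), h1]
    have h3 : F.map (rightMul x) = F.map (rightMul x') := by
      rw [← Category.comp_id (F.map (rightMul x)), ← Category.comp_id (F.map (rightMul x')),
        ← hins (F.map (rightMul x)), ← hins (F.map (rightMul x'))]
      exact Finset.sum_congr rfl fun j _ => by rw [h2]
    rw [← toElem_rightMul x, F.map_injective h3, toElem_rightMul]
  · let φ : F.obj (of R R) ⟶ F.obj (of R R) := ∑ i, ∑ j, s i ≫ rightMul (B i j) ≫ r j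
    obtain ⟨ψ, hψ⟩ := F.map_surjective φ
    refine ⟨toElem ψ, ?_⟩
    ext i j
    rw [hθ, rightMul_toElem, hψ, Matrix.mul_apply]
    simp only [Matrix.mul_apply, hθ1, φ, Preadditive.comp_sum, Preadditive.sum_comp, toElem_sum,
      Finset.sum_mul]
    rw [Finset.sum_comm]
    refine Finset.sum_congr rfl fun j' _ => Finset.sum_congr rfl fun i' _ => ?_
    rw [← toElem_rightMul (B i' j'), ← toElem_comp, ← toElem_comp, toElem_rightMul]
    simp only [Category.assoc]
  · ext j
    simp only [Matrix.vecMul, dotProduct, hθ1, ← toElem_comp, ← toElem_sum]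
    rw [hins]
  · simp only [← toElem_comp, ← toElem_sum, hins, htw, toElem_id]

end Morita

/-! ### Morita equivalence of deformations -/

section DeformationMorita

open FormalSeries PowerSeries

universe w

variable {k : Type v} [CommRing k] {A : Type u} [CommRing A] [Algebra k A]
  {D D' : FormalDeformation k A}

/-- A relation `∑ aₗ ê bₗ = 1` with rows `aₗ` and columns `bₗ` shows that the idempotent matrix `ê` is
full. -/
theorem Matrix.exists_sum_mul_mul_eq_one {R ι κ : Type*} [Ring R] [Fintype ι] [DecidableEq ι]
    [Fintype κ] (ê : Matrix ι ι R) (a b : κ → ι → R)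
    (h : ∑ l, ∑ i, ∑ j, a l i * ê i j * b l j = 1) :
    ∃ p q : ι × κ → Matrix ι ι R, ∑ m, p m * ê * q m = 1 := by
  refine ⟨fun m => Matrix.of fun i j => if i = m.1 then a m.2 j else 0,
    fun m => Matrix.of fun i j => if j = m.1 then b m.2 i else 0, ?_⟩
  ext i j
  simp only [Matrix.sum_apply, Matrix.mul_apply, Matrix.of_apply, ite_mul, zero_mul, mul_ite,
    mul_zero, Fintype.sum_prod_type]
  rw [Finset.sum_eq_single i]
  · rcases eq_or_ne i j with rfl | hij
    · simp only [if_true, Finset.sum_mul, Matrix.one_apply_eq]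
      rw [← h]
      exact Finset.sum_congr rfl fun l _ => Finset.sum_comm
    · simp [Ne.symm hij, Matrix.one_apply_ne hij]
  · intro m _ hm
    simp [Ne.symm hm]
  · simp

/-- A lift of the idempotent of a dual basis of an invertible module is full: a relation
`∑ g (y) = 1` over `A` lifts to a unit `u` of the deformed algebra, by which the columns are divided. -/
theorem DualBasis.exists_full_lift {E : Type w} {ι : Type} [AddCommGroup E] [Module A E]
    [Module.Invertible A E] [Fintype ι] [DecidableEq ι] (b : DualBasis A E ι) {ê : Matrix ι ι D.Alg}
    (ha : ê.map D.aug = b.gram) :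
    ∃ (κ : Type (max u w)) (_ : Fintype κ) (p q : κ → Matrix ι ι D.Alg),
      ∑ m, p m * ê * q m = 1 := by
  obtain ⟨s, hs⟩ := Module.Invertible.exists_sum_eq_one A E
  let u : D.Alg := ∑ l : s, ∑ i, ∑ j,
    D.lift (l.1.1 (b.vec i)) * ê i j * D.lift (b.fn j l.1.2)
  have hu : D.aug u = 1 := by
    have hê : ∀ i j, D.aug (ê i j) = b.gram i j := fun i j => congrFun (congrFun ha i) j
    simp only [u, map_sum, map_mul, D.aug_lift, hê, mul_assoc, ← Finset.mul_sum, b.sum_gram_mul_fn]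
    rw [← hs, ← Finset.sum_coe_sort s]
    refine Finset.sum_congr rfl fun l _ => ?_
    conv_rhs => rw [← b.sum_smul l.1.2, map_sum]
    exact Finset.sum_congr rfl fun i _ => by rw [map_smul, smul_eq_mul, mul_comm]
  obtain ⟨w, hw⟩ := D.isUnit_of_aug_eq_one hu
  obtain ⟨p, q, hpq⟩ := ê.exists_sum_mul_mul_eq_one
    (fun (l : s) i => D.lift (l.1.1 (b.vec i)))
    (fun l j => D.lift (b.fn j l.1.2) * ((w⁻¹ : D.Algˣ) : D.Alg)) (by
      simp only [← mul_assoc, ← Finset.sum_mul]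
      change u * _ = 1
      rw [← hw, Units.mul_inv])
  exact ⟨ι × s, inferInstance, p, q, hpq⟩

/-- A deformation induced by an invertible module is a full corner of a matrix ring, hence Morita
equivalent to the original one. -/
theorem Induces.isMoritaEquivalent {E : Type*} [AddCommGroup E] [Module A E] [Module.Invertible A E]
    {n : ℕ} (b : DualBasis A E (Fin (n + 1))) (h : Induces b.gram D D') :
    IsMoritaEquivalent k⟦X⟧ D.Alg D'.Alg := by
  obtain ⟨θ, hθ⟩ := h
  obtain ⟨hinj, hsurj⟩ := Induces.bijective_onto_corner b.isRankOneIdempotent θ hθ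
  obtain ⟨κ, _, p, q, hpq⟩ := b.exists_full_lift (ê := θ 1) (by rw [hθ, map_one, one_smul])
  refine (IsMoritaEquivalent.matrix (ι := Fin (n + 1)) D.Alg k⟦X⟧).trans k⟦X⟧
    (IsMoritaEquivalent.of_full_corner θ hinj (fun r => hsurj _ ?_ ?_) p q hpq)
  · rw [← mul_assoc, ← mul_assoc, θ.map_one_mul]
  · rw [mul_assoc, θ.map_one_mul]

/-- The dual basis of the image of an idempotent matrix given by its columns and the coordinate
functions. -/
def DualBasis.ofIdempotent {ι : Type*} [Fintype ι] [DecidableEq ι] (e : Matrix ι ι A)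
    (he : e * e = e) : DualBasis A (LinearMap.range e.mulVecLin) ι where
  vec j := ⟨e.mulVecLin (Pi.single j 1), LinearMap.mem_range_self _ _⟩
  fn i := (LinearMap.proj i).comp (Submodule.subtype _)
  sum_smul := by
    rintro ⟨-, z, rfl⟩
    apply Subtype.ext
    rw [Submodule.coe_sum]
    simp only [LinearMap.comp_apply, Submodule.subtype_apply, LinearMap.proj_apply,
      Submodule.coe_smul, ← map_smul, ← map_sum]
    simp only [← Pi.single_smul, smul_eq_mul, mul_one, Finset.univ_sum_single]
    rw [Matrix.mulVecLin_apply, Matrix.mulVecLin_apply, Matrix.mulVec_mulVec, he]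

theorem DualBasis.gram_ofIdempotent {ι : Type*} [Fintype ι] [DecidableEq ι] (e : Matrix ι ι A)
    (he : e * e = e) : (ofIdempotent e he).gram = e := by
  ext i j
  simp [gram_apply, ofIdempotent]

/-- The matrix of an endomorphism with respect to a dual basis. -/
def DualBasis.endMatrix {E ι : Type*} [AddCommGroup E] [Module A E] [Fintype ι]
    (b : DualBasis A E ι) (φ : Module.End A E) : Matrix ι ι A :=
  Matrix.of fun i j => b.fn i (φ (b.vec j))

namespace DualBasis

variable {E ι : Type*} [AddCommGroup E] [Module A E] [Fintype ι] (b : DualBasis A E ι)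

theorem endMatrix_mul (φ χ : Module.End A E) :
    b.endMatrix (φ * χ) = b.endMatrix φ * b.endMatrix χ := by
  ext i j
  rw [Matrix.mul_apply]
  change b.fn i (φ (χ (b.vec j))) = ∑ m, b.fn i (φ (b.vec m)) * b.fn m (χ (b.vec j))
  conv_lhs => rw [← b.sum_smul (χ (b.vec j))]
  simp [mul_comm]

theorem gram_mul_endMatrix (φ : Module.End A E) : b.gram * b.endMatrix φ = b.endMatrix φ := by
  conv_rhs => rw [← one_mul φ, endMatrix_mul]
  rfl

theorem endMatrix_mul_gram (φ : Module.End A E) : b.endMatrix φ * b.gram = b.endMatrix φ := by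
  conv_rhs => rw [← mul_one φ, endMatrix_mul]
  rfl

theorem endMatrix_injective : Function.Injective b.endMatrix := by
  intro φ χ h
  ext y
  rw [← b.sum_smul y, map_sum, map_sum]
  refine Finset.sum_congr rfl fun j _ => ?_
  rw [map_smul, map_smul, ← b.sum_smul (φ (b.vec j)), ← b.sum_smul (χ (b.vec j))]
  congr 1
  refine Finset.sum_congr rfl fun i _ => ?_
  congr 1
  exact congrFun (congrFun h i) j

end DualBasis

section FromMatrix

variable {ι : Type*} [Fintype ι] (θ : D'.Alg →ₙₐ[k⟦X⟧] Matrix ι ι D.Alg)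

theorem map_aug_eq_of_aug_eq {d d' : D'.Alg} (h : D'.aug d = D'.aug d') :
    (θ d).map D.aug = (θ d').map D.aug := by
  obtain ⟨z, hz⟩ := D'.exists_eq_X_smul (a := d - d') (by rw [map_sub, h, sub_self])
  rw [← sub_eq_zero, ← D.map_aug_sub, ← map_sub, hz, map_smul, D.map_aug_X_smul]

theorem map_aug_one_mul_self : (θ 1).map D.aug * (θ 1).map D.aug = (θ 1).map D.aug := by
  rw [← D.map_aug_mul, θ.map_one_mul]

/-- The image modulo `λ` of the idempotent of a full corner isomorphic to a deformation is
invertible: it is a generator, and its endomorphisms commute because they lift to elements of the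
deformation, which commute modulo `λ`. -/
theorem DualBasis.invertible_of_corner {E κ : Type*} [AddCommGroup E] [Module A E]
    (b : DualBasis A E ι) (hb : b.gram = (θ 1).map D.aug) (hθ : ∀ B, ∃ d, θ d = θ 1 * B * θ 1)
    [Fintype κ] (p q : κ → ι → D.Alg) (hp : ∀ l, Matrix.vecMul (p l) (θ 1) = p l)
    (hpq : ∑ l, ∑ j, p l j * q l j = 1) : Module.Invertible A E := by
  have hlift : ∀ φ : Module.End A E, ∃ d, (θ d).map D.aug = b.endMatrix φ := fun φ => by
    obtain ⟨d, hd⟩ := hθ ((b.endMatrix φ).map D.lift)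
    refine ⟨d, ?_⟩
    rw [hd, D.map_aug_mul, D.map_aug_mul, D.map_aug_map_lift, ← hb, b.gram_mul_endMatrix,
      b.endMatrix_mul_gram]
  refine Module.Invertible.of_sum_eq_one (fun l => ∑ j, D.aug (q l j) • b.vec j)
    (fun l => ∑ i, D.aug (p l i) • b.fn i) ?_ fun φ χ => b.endMatrix_injective ?_
  · rw [← map_one D.aug, ← hpq, map_sum]
    refine Finset.sum_congr rfl fun l _ => ?_
    have h : ∀ j, ∑ i, D.aug (p l i) * b.gram i j = D.aug (p l j) := fun j => by
      conv_rhs => rw [← hp l]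
      simp only [Matrix.vecMul, dotProduct, map_sum, map_mul, hb, Matrix.map_apply]
    rw [LinearMap.sum_apply]
    simp only [LinearMap.smul_apply, b.fn_sum_smul, smul_eq_mul, Finset.mul_sum]
    rw [map_sum]
    simp only [map_mul]
    rw [Finset.sum_comm]
    refine Finset.sum_congr rfl fun j _ => ?_
    simp only [← mul_assoc, ← Finset.sum_mul]
    rw [h]
  · obtain ⟨d, hd⟩ := hlift φ
    obtain ⟨d', hd'⟩ := hlift χ
    rw [b.endMatrix_mul, b.endMatrix_mul, ← hd, ← hd', ← D.map_aug_mul, ← D.map_aug_mul, ← map_mul,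
      ← map_mul]
    exact map_aug_eq_of_aug_eq θ (by rw [map_mul, map_mul, mul_comm])

/-- An isomorphism of `D'` with a corner of rank one modulo `λ` reduces modulo `λ` to an automorphism
of `A`. -/
theorem exists_algEquiv_map_aug (he : IsRankOneIdempotent ((θ 1).map D.aug))
    (hinj : Function.Injective θ) (hθ : ∀ B, ∃ d, θ d = θ 1 * B * θ 1) :
    ∃ ψ : A ≃ₐ[k] A, ∀ d, (θ d).map D.aug = ψ (D'.aug d) • (θ 1).map D.aug := by
  classical
  have hex : ∀ a, ∃ c : A, (θ (D'.lift a)).map D.aug = c • (θ 1).map D.aug := fun a =>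
    he.exists_smul _ (by rw [← D.map_aug_mul, ← D.map_aug_mul, θ.map_one_mul, θ.mul_map_one])
  choose f hf using hex
  have hfd : ∀ d, (θ d).map D.aug = f (D'.aug d) • (θ 1).map D.aug := fun d => by
    rw [← hf]
    exact map_aug_eq_of_aug_eq θ (D'.aug_lift _).symm
  have huniq : ∀ {a c : A}, a • (θ 1).map D.aug = c • (θ 1).map D.aug → a = c := fun h =>
    sub_eq_zero.1 (he.eq_zero_of_smul _ (by rw [sub_smul, h, sub_self]))
  have hf1 : f 1 = 1 := huniq (by rw [← map_one D'.aug, ← hfd, map_one D'.aug, one_smul])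
  let ψ : A →ₐ[k] A := AlgHom.ofLinearMap
    { toFun := f
      map_add' := fun a c => huniq (by
        rw [← hf, D'.lift_add, map_add, add_smul, ← hf, ← hf]
        exact Matrix.map_add D.aug (map_add D.aug) _ _)
      map_smul' := fun c a => huniq (by
        rw [← hf, D'.lift_smul, map_smul, D.map_aug_smul, constantCoeff_C, hf, smul_assoc,
          RingHom.id_apply]) }
    hf1 (fun a c => huniq (by
      have h := D.map_aug_mul (θ (D'.lift a)) (θ (D'.lift c))
      rw [← map_mul θ, hfd, hf, hf, map_mul D'.aug, D'.aug_lift, D'.aug_lift, Matrix.smul_mul,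
        Matrix.mul_smul, he.mul_self, smul_smul] at h
      exact h))
  refine ⟨AlgEquiv.ofBijective ψ ⟨?_, fun c => ?_⟩, hfd⟩
  · rw [injective_iff_map_eq_zero]
    intro a ha
    have h0 : (θ (D'.lift a)).map D.aug = 0 := by
      rw [hf]
      change ψ a • _ = _
      rw [ha, zero_smul]
    obtain ⟨W, hW⟩ := D.exists_matrix_eq_X_smul h0
    obtain ⟨w, hw⟩ := hθ W
    have h1 : θ (D'.lift a) = θ ((X : k⟦X⟧) • w) := by
      rw [map_smul, hw, ← Matrix.smul_mul, ← Matrix.mul_smul, ← hW, θ.map_one_mul, θ.mul_map_one]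
    rw [← D'.aug_lift a, hinj h1, D'.aug_X_smul]
  · obtain ⟨d, hd⟩ := hθ (((c • (θ 1).map D.aug)).map D.lift)
    refine ⟨D'.aug d, huniq ?_⟩
    change f _ • _ = _
    rw [← hfd, hd, D.map_aug_mul, D.map_aug_mul, D.map_aug_map_lift, Matrix.mul_smul,
      Matrix.smul_mul, he.mul_self, he.mul_self]

end FromMatrix

/-- Two deformations are Morita equivalent if and only if they are related by the Picard group, up to
an automorphism of `A`. -/
theorem isMoritaEquivalent_iff_exists_actDefaHom :
    IsMoritaEquivalent k⟦X⟧ D.Alg D'.Alg ↔ ∃ (ψ : A ≃ₐ[k] A) (P : CommRing.Pic A),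
      CommRing.Pic.actDefaHom k A P D.toDefa = (FormalDeformation.pullback ψ D').toDefa := by
  constructor
  · intro h
    -- the equivalence is inverted because `D'` has to be a corner of a matrix ring over `D`
    obtain ⟨n, θ, hinj, hθ, m, p, q, hp, hpq⟩ := (h.symm k⟦X⟧).exists_matrix
    have he := map_aug_one_mul_self θ
    let b := DualBasis.ofIdempotent _ he
    have hb : b.gram = (θ 1).map D.aug := DualBasis.gram_ofIdempotent _ he
    have hinv := b.invertible_of_corner θ hb hθ p q hp hpq
    obtain ⟨ψ, hψ⟩ := exists_algEquiv_map_aug θ (hb ▸ b.isRankOneIdempotent) hinj hθ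
    refine ⟨ψ.symm, CommRing.Pic.mk A (LinearMap.range ((θ 1).map D.aug).mulVecLin), ?_⟩
    rw [CommRing.Pic.actDefaHom_eq_iff b, hb]
    obtain ⟨T, hT⟩ := D'.exists_algEquiv_pullback ψ.symm
    refine ⟨θ.comp (AlgHom.toNonUnitalAlgHom T.toAlgHom), fun d => ?_⟩
    change (θ (T d)).map D.aug = _
    rw [hψ, hT, ψ.apply_symm_apply]
  · rintro ⟨ψ, P, h⟩
    obtain ⟨T, -⟩ := D'.exists_algEquiv_pullback ψ
    have h' := (CommRing.Pic.actDefa_eq_iff P _ _).1 h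
    exact (h'.isMoritaEquivalent P.dualBasis).trans k⟦X⟧ (IsMoritaEquivalent.of_algEquiv k⟦X⟧ T)

end DeformationMorita

theorem mainTheorem6 {k : Type v} [CommRing k] [CharZero k]
    {A : Type u} [CommRing A] [Algebra k A] :
    ∃ Φ : CommRing.Pic A →* Equiv.Perm (Defa k A),
      (∀ (E : Type u) [AddCommGroup E] [Module k E] [Module A E] [IsScalarTower k A E]
          [Module.Invertible A E] (D D' : FormalDeformation k A),
        Φ (CommRing.Pic.mk A E) D.toDefa = D'.toDefa ↔ IsInducedBy E D D') ∧
      (∀ (P : CommRing.Pic A) (D D' : FormalDeformation k A),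
        Φ P D.toDefa = D'.toDefa → D'.poissonBracket = D.poissonBracket) ∧
      (∀ D D' : FormalDeformation k A,
        IsMoritaEquivalent (PowerSeries k) D.Alg D'.Alg ↔
          ∃ (ψ : A ≃ₐ[k] A) (P : CommRing.Pic A),
            Φ P D.toDefa = (FormalDeformation.pullback ψ D').toDefa) :=
  ⟨CommRing.Pic.actDefaHom k A, fun E => CommRing.Pic.actDefaHom_eq_iff_isInducedBy E,
    CommRing.Pic.poissonBracket_eq_of_actDefaHom, fun _ _ =>
      isMoritaEquivalent_iff_exists_actDefaHom⟩
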